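/- Machine model: a random access machine (structured programs with integer and real variables and arrays, indirect addressing, unit-cost addition, subtraction and comparison, and calls of a subroutine; a call costs one step, plus the size of the input handed over, plus the running time of the subroutine; writing out each word of an output costs one step). A graph is a simple undirected graph on the vertices $0,\dots,n-1$ with positive real edge weights, given as a list of its $m$ edges, and $\log$ is to base $2$. $k$-SiSP: given such a graph, $k\ge 1$ and vertices $s\ne t$, output $k$ shortest simple paths from $s$ to $t$, pairwise different and in nondecreasing order of weight, as vertex sequences (all the simple paths if there are fewer than $k$). $k$-SiSC: given such a graph, $k\ge 1$ and a vertex $x$, output in the same way $k$ shortest simple cycles through $x$, pairwise different as edge sets (all of them if there are fewer than $k$). A program $R$ is a tilde-sparse $f(m,n)$ reduction from a graph problem $P$ to a graph problem $Q$ (written $P\lesssim^{\mathrm{sprs}}_{f(m,n)}Q$ if such an $R$ exists) if, with any algorithm for $Q$ as its subroutine, $R$ solves $P$ on graphs with $n$ vertices and $m$ edges by making $(1+\log n)^{O(1)}$ calls, with the same parameter $k$, on graphs with $\tilde O(n)$ vertices and $\tilde O(m)$ edges; and if the algorithm for $Q$ runs in time $T_Q(m,n)$ (possibly depending on $k$),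 where $T_Q$ is nondecreasing in $m$ and $n$ and $T_Q(2m,2n)=O(T_Q(m,n))$ for $n\ge 2$, then $R$ solves $P$ in time $\tilde O(T_Q(m,n)+f(m,n))$. Here $\tilde O$ hides factors polylogarithmic in $n$, uniformly in $k$. For a graph $G$, a vertex $x$ and $i\ge 0$, let $G_i$ be the graph obtained from $G$ by replacing $x$ with two vertices $x_0,x_1$ and each edge $xy$ with the edge $x_0y$ if the $i$-th bit of $y$ is $0$ and with $x_1y$ if it is $1$, keeping all other edges and all weights. So $G_i$ has $n+1$ vertices and $m$ edges. **Lemma.** There is a program $R$ with the following properties. 1. $R$ is a tilde-sparse $(m+n)$ reduction from $k$-SiSC to $k$-SiSP in undirected graphs. In particular $k\text{-SiSC}\lesssim^{\mathrm{sprs}}_{(m+n)}k\text{-SiSP}$. 2. On the instance $(G,k,x)$, $R$ calls the $k$-SiSP algorithm exactly once on each of the instances $(G_i,k,x_0,x_1)$, $0\le i<\lceil\log n\rceil$, and nowhere else; and for an arbitrary function $T_Q$ bounding the running time of that algorithm, $R$ takes at most $C(1+\lceil\log n\rceil)^d\,(T_Q(m,n+1)+m+n)$ steps, with absolute constants $C,d$.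 3. With any program for $k$-SiSP that runs in time $O(k(m+n\log n))$ as its subroutine (the algorithm of Katoh, Ibaraki and Mine has this running time), $R$ solves $k$-SiSC for $n\ge 2$ in time $O(k\log n\,(m+n\log n))$. -/

import Mathlib

/-! ### A random access machine with real weights

Programs are structured RAM programs.  The memory consists of named integer variables, named
unbounded integer arrays (with indirect addressing) and named unbounded arrays of reals, all
initially zero.  Integers can be added, subtracted (truncated at zero) and compared, reals can be
added, subtracted and compared.  Every assignment and every test costs one step; since a fixed
program contains only finitely many expressions, evaluating one takes constantly many elementary
operations.  A program may call a subroutine. -/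

/-- The contents of the memory. -/
structure Store where
  var : ℕ → ℕ
  arr : ℕ → ℕ → ℕ
  wts : ℕ → ℕ → ℝ

/-- Integer expressions. -/
inductive NExpr where
  | const (c : ℕ)
  | var (x : ℕ)
  | arr (a : ℕ) (i : NExpr)
  | add (e₁ e₂ : NExpr)
  | sub (e₁ e₂ : NExpr)

def NExpr.eval (σ : Store) : NExpr → ℕ
  | .const c => c
  | .var x => σ.var x
  | .arr a i => σ.arr a (i.eval σ)
  | .add e₁ e₂ => e₁.eval σ + e₂.eval σ
  | .sub e₁ e₂ => e₁.eval σ - e₂.eval σ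

/-- Real expressions. -/
inductive RExpr where
  | zero
  | wts (b : ℕ) (i : NExpr)
  | add (r₁ r₂ : RExpr)
  | sub (r₁ r₂ : RExpr)

noncomputable def RExpr.eval (σ : Store) : RExpr → ℝ
  | .zero => 0
  | .wts b i => σ.wts b (i.eval σ)
  | .add r₁ r₂ => r₁.eval σ + r₂.eval σ
  | .sub r₁ r₂ => r₁.eval σ - r₂.eval σ

/-- Tests. -/
inductive Test where
  | le (e₁ e₂ : NExpr)
  | rle (r₁ r₂ : RExpr)
  | not (b : Test)
  | and (b₁ b₂ : Test)

def Test.holds (σ : Store) : Test → Prop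
  | .le e₁ e₂ => e₁.eval σ ≤ e₂.eval σ
  | .rle r₁ r₂ => r₁.eval σ ≤ r₂.eval σ
  | .not b => ¬ b.holds σ
  | .and b₁ b₂ => b₁.holds σ ∧ b₂.holds σ

/-- Programs.  `call a la b lb r x` passes the first `la` words of the integer array `a` and the
first `lb` entries of the real array `b` by value to the subroutine; the output words are stored at
the beginning of the integer array `r`, and their number in the variable `x`. -/
inductive Prog where
  | skip
  | setVar (x : ℕ) (e : NExpr)
  | setArr (a : ℕ) (i e : NExpr)
  | setWts (b : ℕ) (i : NExpr) (r : RExpr)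
  | seq (c₁ c₂ : Prog)
  | ite (b : Test) (c₁ c₂ : Prog)
  | while (b : Test) (c : Prog)
  | call (a : ℕ) (la : NExpr) (b : ℕ) (lb : NExpr) (r x : ℕ)

namespace Store

def setVar (σ : Store) (x v : ℕ) : Store :=
  { σ with var := Function.update σ.var x v }

def setArr (σ : Store) (a i v : ℕ) : Store :=
  { σ with arr := Function.update σ.arr a (Function.update (σ.arr a) i v) }

noncomputable def setWts (σ : Store) (b i : ℕ) (v : ℝ) : Store :=
  { σ with wts := Function.update σ.wts b (Function.update (σ.wts b) i v) }

/-- Store the words of `l` at the beginning of the array `a`. -/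
def putArr (σ : Store) (a : ℕ) (l : List ℕ) : Store :=
  { σ with arr := Function.update σ.arr a (fun i => (l[i]?).getD (σ.arr a i)) }

end Store

/-- An input: a finite sequence of integer words and a finite sequence of reals. -/
abbrev Input := List ℕ × List ℝ

/-- The input/output behaviour of an algorithm together with its running time: `A d out t` means
that `A`, started on the input `d`, halts after `t` steps with output `out`. -/
abbrev Algo := Input → List ℕ → ℕ → Prop

/-- An algorithm is deterministic, and it spends at least one step on each word of its output. -/
structure Algo.IsAlgorithm (A : Algo) : Prop where
  det : ∀ {d o₁ t₁ o₂ t₂}, A d o₁ t₁ → A d o₂ t₂ → o₁ = o₂ ∧ t₁ = t₂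
  length_le : ∀ {d o t}, A d o t → o.length ≤ t

/-- The input that a call hands over. -/
def Store.callInput (σ : Store) (a : ℕ) (la : NExpr) (b : ℕ) (lb : NExpr) : Input :=
  ((List.range (la.eval σ)).map (σ.arr a), (List.range (lb.eval σ)).map (σ.wts b))

/-- `Exec O c σ σ' t q`: with `O` as the subroutine, the program `c` started in the store `σ` halts
in `σ'` after `t` steps, and `q` is the list of the inputs on which the subroutine was called, in
chronological order.  A call costs one step, plus the number of words and reals handed over, plus
the running time of the subroutine (which includes the length of its output). -/
inductive Exec (O : Algo) : Prog → Store → Store → ℕ → List Input → Prop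
  | skip (σ) : Exec O .skip σ σ 1 []
  | setVar (x e σ) : Exec O (.setVar x e) σ (σ.setVar x (e.eval σ)) 1 []
  | setArr (a i e σ) : Exec O (.setArr a i e) σ (σ.setArr a (i.eval σ) (e.eval σ)) 1 []
  | setWts (b i r σ) : Exec O (.setWts b i r) σ (σ.setWts b (i.eval σ) (r.eval σ)) 1 []
  | seq {c₁ c₂ σ₁ σ₂ σ₃ t₁ t₂ q₁ q₂} :
      Exec O c₁ σ₁ σ₂ t₁ q₁ → Exec O c₂ σ₂ σ₃ t₂ q₂ →
      Exec O (.seq c₁ c₂) σ₁ σ₃ (t₁ + t₂) (q₁ ++ q₂)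
  | iteTrue {b c₁ c₂ σ σ' t q} : b.holds σ → Exec O c₁ σ σ' t q →
      Exec O (.ite b c₁ c₂) σ σ' (t + 1) q
  | iteFalse {b c₁ c₂ σ σ' t q} : ¬ b.holds σ → Exec O c₂ σ σ' t q →
      Exec O (.ite b c₁ c₂) σ σ' (t + 1) q
  | whileFalse {b c σ} : ¬ b.holds σ → Exec O (.while b c) σ σ 1 []
  | whileTrue {b c σ₁ σ₂ σ₃ t₁ t₂ q₁ q₂} : b.holds σ₁ → Exec O c σ₁ σ₂ t₁ q₁ →
      Exec O (.while b c) σ₂ σ₃ t₂ q₂ →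
      Exec O (.while b c) σ₁ σ₃ (t₁ + t₂ + 1) (q₁ ++ q₂)
  | call {a la b lb r x σ out t} : O (σ.callInput a la b lb) out t →
      Exec O (.call a la b lb r x) σ ((σ.putArr r out).setVar x out.length)
        (1 + (σ.callInput a la b lb).1.length + (σ.callInput a la b lb).2.length + t)
        [σ.callInput a la b lb]

/-- The initial store: the input is in the integer array `0` and in the real array `0`. -/
def Store.init (d : Input) : Store where
  var := fun _ => 0
  arr := fun a i => if a = 0 then d.1.getD i 0 else 0
  wts := fun b i => if b = 0 then d.2.getD i 0 else 0

/-- The output: the first words of the integer array `1`, their number being the variable `0`. -/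
def Store.output (σ : Store) : List ℕ := (List.range (σ.var 0)).map (σ.arr 1)

/-- The program `c` with subroutine `O` halts on input `d` with output `out` after `t` steps
(one further step being charged for each word of the output), having called `O` on the inputs `q`. -/
def Prog.Halts (c : Prog) (O : Algo) (d : Input) (out : List ℕ) (t : ℕ) (q : List Input) : Prop :=
  ∃ σ t₀, Exec O c (Store.init d) σ t₀ q ∧ out = σ.output ∧ t = t₀ + out.length

/-- The algorithm given by the program `c` with subroutine `O`. -/
def Prog.algoWith (c : Prog) (O : Algo) : Algo := fun d out t => ∃ q, c.Halts O d out t q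

/-- The algorithm given by the program `c` on its own (any call of a subroutine fails). -/
def Prog.algo (c : Prog) : Algo := c.algoWith (fun _ _ _ => False)

theorem Exec.det {O : Algo} (hO : O.IsAlgorithm) {c σ σ₁ t₁ q₁} (h₁ : Exec O c σ σ₁ t₁ q₁) :
    ∀ {σ₂ t₂ q₂}, Exec O c σ σ₂ t₂ q₂ → σ₁ = σ₂ ∧ t₁ = t₂ ∧ q₁ = q₂ := by
  induction h₁ with
  | skip σ => intro _ _ _ h; cases h; simp
  | setVar x e σ => intro _ _ _ h; cases h; simp
  | setArr a i e σ => intro _ _ _ h; cases h; simp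
  | setWts b i r σ => intro _ _ _ h; cases h; simp
  | seq _ _ ih₁ ih₂ =>
    intro _ _ _ h; cases h with
    | seq g₁ g₂ =>
      obtain ⟨rfl, rfl, rfl⟩ := ih₁ g₁
      obtain ⟨rfl, rfl, rfl⟩ := ih₂ g₂
      simp
  | iteTrue hb _ ih =>
    intro _ _ _ h; cases h with
    | iteTrue _ g => obtain ⟨rfl, rfl, rfl⟩ := ih g; simp
    | iteFalse hb' _ => exact absurd hb hb'
  | iteFalse hb _ ih =>
    intro _ _ _ h; cases h with
    | iteTrue hb' _ => exact absurd hb' hb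
    | iteFalse _ g => obtain ⟨rfl, rfl, rfl⟩ := ih g; simp
  | whileFalse hb =>
    intro _ _ _ h; cases h with
    | whileFalse _ => simp
    | whileTrue hb' _ _ => exact absurd hb' hb
  | whileTrue hb _ _ ih₁ ih₂ =>
    intro _ _ _ h; cases h with
    | whileFalse hb' => exact absurd hb hb'
    | whileTrue _ g₁ g₂ =>
      obtain ⟨rfl, rfl, rfl⟩ := ih₁ g₁
      obtain ⟨rfl, rfl, rfl⟩ := ih₂ g₂
      simp
  | call ho =>
    intro _ _ _ h; cases h with
    | call ho' => obtain ⟨rfl, rfl⟩ := hO.det ho ho'; simp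

/-- Programs are algorithms. -/
theorem Prog.algoWith_isAlgorithm (c : Prog) {O : Algo} (hO : O.IsAlgorithm) :
    (c.algoWith O).IsAlgorithm where
  det := by
    rintro d o₁ t₁ o₂ t₂ ⟨_, σ₁, s₁, h₁, rfl, rfl⟩ ⟨_, σ₂, s₂, h₂, rfl, rfl⟩
    obtain ⟨rfl, rfl, _⟩ := h₁.det hO h₂
    exact ⟨rfl, rfl⟩
  length_le := by
    rintro d o t ⟨_, σ, s, _, rfl, rfl⟩
    omega

theorem Prog.algo_isAlgorithm (c : Prog) : c.algo.IsAlgorithm :=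
  c.algoWith_isAlgorithm ⟨fun h => h.elim, fun h => h.elim⟩

/-! ### Graph problems and sparse reductions -/

/-- A graph problem: its instances with their number of vertices, their number of edges and a
further numerical parameter, the input that presents an instance to an algorithm, and the outputs
that are correct for an instance. -/
structure GraphProblem where
  Inst : Type
  numV : Inst → ℕ
  numE : Inst → ℕ
  par : Inst → ℕ
  enc : Inst → Input
  Correct : Inst → List ℕ → Prop

/-- `A` solves the problem `P`, taking at most `T I` steps on each instance `I`. -/
def Algo.SolvesIn (A : Algo) (P : GraphProblem) (T : P.Inst → ℕ) : Prop :=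
  ∀ I, ∃ out t, A (P.enc I) out t ∧ P.Correct I out ∧ t ≤ T I

/-- `A` solves the problem `P`. -/
def Algo.Solves (A : Algo) (P : GraphProblem) : Prop :=
  ∀ I, ∃ out t, A (P.enc I) out t ∧ P.Correct I out

/-- A time bound `T n m k` that is nondecreasing in `n` and `m` and grows at most by the
factor `D` when `n` and `m` are doubled. -/
def RegularBound (D : ℕ) (T : ℕ → ℕ → ℕ → ℕ) : Prop :=
  (∀ n n' m m' k, n ≤ n' → m ≤ m' → T n m k ≤ T n' m' k) ∧
  ∀ n m k, 2 ≤ n → T (2 * n) (2 * m) k ≤ D * T n m k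

/-- The program `R` is a tilde-`f(m,n)` sparse reduction from `P` to `Q`: with any algorithm for `Q`
as a subroutine it solves `P`, making polylogarithmically many calls, with the same parameter and
on graphs with `Õ(n)` vertices and `Õ(m)` edges; and if the algorithm for `Q` runs in time
`T_Q(m,n)`, then `P` is solved in time `Õ(T_Q(m,n) + f(m,n))`. -/
def Prog.IsTildeSparseReduction (R : Prog) (P Q : GraphProblem) (f : ℕ → ℕ → ℕ) : Prop :=
  (∃ C d : ℕ, ∀ A : Algo, A.IsAlgorithm → A.Solves Q → ∀ I : P.Inst, ∃ out t q,
      R.Halts A (P.enc I) out t q ∧ P.Correct I out ∧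
      q.length ≤ C * (Nat.clog 2 (P.numV I) + 1) ^ d ∧
      ∀ y ∈ q, ∃ J : Q.Inst, y = Q.enc J ∧ Q.par J = P.par I ∧
        Q.numV J ≤ C * (Nat.clog 2 (P.numV I) + 1) ^ d * P.numV I ∧
        Q.numE J ≤ C * (Nat.clog 2 (P.numV I) + 1) ^ d * P.numE I) ∧
  ∀ D : ℕ, ∃ C d : ℕ, ∀ (A : Algo) (T : ℕ → ℕ → ℕ → ℕ), A.IsAlgorithm → RegularBound D T →
      A.SolvesIn Q (fun J => T (Q.numV J) (Q.numE J) (Q.par J)) →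
      (R.algoWith A).SolvesIn P (fun I => C * (Nat.clog 2 (P.numV I) + 1) ^ d *
        (T (P.numV I) (P.numE I) (P.par I) + f (P.numE I) (P.numV I)))

/-! ### Weighted undirected graphs, shortest simple paths and cycles -/

/-- A simple undirected graph on the vertex labels `0, …, n - 1` with positive edge weights,
presented by a list of its `m` edges. -/
structure WGraph where
  n : ℕ
  G : SimpleGraph (Fin n)
  w : Sym2 (Fin n) → ℝ
  w_pos : ∀ e ∈ G.edgeSet, 0 < w e
  m : ℕ
  edge : Fin m → Fin n × Fin n
  edge_inj : Function.Injective fun j => s((edge j).1, (edge j).2)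
  edge_range : (Set.range fun j => s((edge j).1, (edge j).2)) = G.edgeSet

namespace WGraph

/-- The endpoints of the edges, edge by edge. -/
def edgeWords (X : WGraph) : List ℕ :=
  (List.finRange X.m).flatMap fun j => [((X.edge j).1 : ℕ), ((X.edge j).2 : ℕ)]

/-- The weights of the edges, edge by edge. -/
def edgeWeights (X : WGraph) : List ℝ :=
  (List.finRange X.m).map fun j => X.w s((X.edge j).1, (X.edge j).2)

/-- The weight of a walk. -/
noncomputable def weight (X : WGraph) {u v : Fin X.n} (p : X.G.Walk u v) : ℝ :=
  (p.edges.map X.w).sum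

/-- The simple cycles through `x`, traversed from `x`. -/
abbrev CycleAt (X : WGraph) (x : Fin X.n) : Type := {c : X.G.Walk x x // c.IsCycle}

/-- A cycle as an undirected subgraph, i.e. as a set of edges; in particular the two directions in
which a cycle can be traversed give the same cycle. -/
def CycleAt.edgeSet {X : WGraph} {x : Fin X.n} (c : X.CycleAt x) : Set (Sym2 (Fin X.n)) :=
  {e | e ∈ c.1.edges}

end WGraph

/-- `l` lists `k` lightest objects of the type `α` (all of them if there are fewer than `k`) in
nondecreasing order of weight; two objects count as the same if they have the same `key`. -/
def IsKLightest {α β : Type} (key : α → β) (wt : α → ℝ) (k : ℕ) (l : List α) : Prop :=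
  (l.map key).Nodup ∧
  l.Pairwise (fun a b => wt a ≤ wt b) ∧
  l.length ≤ k ∧
  (l.length < k → ∀ a, key a ∈ l.map key) ∧
  ∀ a, key a ∉ l.map key → ∀ b ∈ l, wt b ≤ wt a

/-- A list of vertex sequences as a sequence of words: the number of sequences, followed by each
sequence, preceded by its length. -/
def encodeSeqs (l : List (List ℕ)) : List ℕ :=
  l.length :: l.flatMap fun p => p.length :: p

structure KSiSPInst where
  X : WGraph
  k : ℕ
  k_pos : 1 ≤ k
  s : Fin X.n
  t : Fin X.n
  s_ne_t : s ≠ t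

structure KSiSCInst where
  X : WGraph
  k : ℕ
  k_pos : 1 ≤ k
  x : Fin X.n

/-- `k` shortest simple paths from `s` to `t` in an undirected graph. -/
def kSiSP : GraphProblem where
  Inst := KSiSPInst
  numV I := I.X.n
  numE I := I.X.m
  par I := I.k
  enc I := ([I.X.n, I.X.m, I.k, (I.s : ℕ), (I.t : ℕ)] ++ I.X.edgeWords, I.X.edgeWeights)
  Correct I out := ∃ l : List (I.X.G.Path I.s I.t),
    IsKLightest id (fun p => I.X.weight p.1) I.k l ∧
    out = encodeSeqs (l.map fun p => p.1.support.map Fin.val)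

/-- `k` shortest simple cycles through `x` in an undirected graph. -/
def kSiSC : GraphProblem where
  Inst := KSiSCInst
  numV I := I.X.n
  numE I := I.X.m
  par I := I.k
  enc I := ([I.X.n, I.X.m, I.k, (I.x : ℕ)] ++ I.X.edgeWords, I.X.edgeWeights)
  Correct I out := ∃ l : List (I.X.CycleAt I.x),
    IsKLightest WGraph.CycleAt.edgeSet (fun c => I.X.weight c.1) I.k l ∧
    out = encodeSeqs (l.map fun c => c.1.support.map Fin.val)

/-! ### Splitting a vertex by bit-sampling -/

namespace WGraph

/-- The endpoint that replaces the endpoint `u` of an edge `uv` when `x` is split according to the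
`i`-th bit of its neighbours: the two copies `x₀`, `x₁` of `x` are the labels `x` and `n`. -/
def redirect (X : WGraph) (x : Fin X.n) (i : ℕ) (u v : Fin X.n) : Fin (X.n + 1) :=
  if u = x ∧ (v : ℕ).testBit i = true then Fin.last X.n else u.castSucc

/-- The map that identifies the two copies of `x` again. -/
def collapse (X : WGraph) (x : Fin X.n) : Fin (X.n + 1) → Fin X.n :=
  Fin.lastCases x id

theorem collapse_redirect (X : WGraph) (x : Fin X.n) (i : ℕ) (u v : Fin X.n) :
    X.collapse x (X.redirect x i u v) = u := by
  unfold redirect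
  split_ifs with h
  · simp [collapse, h.1]
  · simp [collapse]

/-- The edge `j` of the graph in which `x` is split. -/
def splitEdge (X : WGraph) (x : Fin X.n) (i : ℕ) (j : Fin X.m) : Fin (X.n + 1) × Fin (X.n + 1) :=
  (X.redirect x i (X.edge j).1 (X.edge j).2, X.redirect x i (X.edge j).2 (X.edge j).1)

theorem map_splitEdge (X : WGraph) (x : Fin X.n) (i : ℕ) (j : Fin X.m) :
    Sym2.map (X.collapse x) s((X.splitEdge x i j).1, (X.splitEdge x i j).2) =
      s((X.edge j).1, (X.edge j).2) := by
  simp [splitEdge, collapse_redirect]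

theorem edge_ne (X : WGraph) (j : Fin X.m) : (X.edge j).1 ≠ (X.edge j).2 := by
  have h : s((X.edge j).1, (X.edge j).2) ∈ X.G.edgeSet := X.edge_range ▸ ⟨j, rfl⟩
  exact (SimpleGraph.mem_edgeSet _ |>.1 h).ne

/-- The bit-sampled graph: `x` is replaced by two vertices `x₀` and `x₁`; each edge `xy` becomes
`x₀y` if the `i`-th bit of the label `y` is `0`, and `x₁y` if it is `1`.  All other edges, and all
weights, are kept. -/
def split (X : WGraph) (x : Fin X.n) (i : ℕ) : WGraph where
  n := X.n + 1
  G := SimpleGraph.fromEdgeSet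
    (Set.range fun j => s((X.splitEdge x i j).1, (X.splitEdge x i j).2))
  w e := X.w (e.map (X.collapse x))
  w_pos := by
    intro e he
    rw [SimpleGraph.edgeSet_fromEdgeSet] at he
    obtain ⟨⟨j, rfl⟩, _⟩ := he
    simp only [map_splitEdge]
    exact X.w_pos _ (X.edge_range ▸ ⟨j, rfl⟩)
  m := X.m
  edge := X.splitEdge x i
  edge_inj := by
    intro j j' h
    have h' := congrArg (Sym2.map (X.collapse x)) h
    simp only [map_splitEdge] at h'
    exact X.edge_inj h'
  edge_range := by
    rw [SimpleGraph.edgeSet_fromEdgeSet, eq_comm, sdiff_eq_left, Set.disjoint_left]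
    rintro _ ⟨j, rfl⟩ h
    have h2 : (X.splitEdge x i j).1 = (X.splitEdge x i j).2 := by simpa using h
    apply X.edge_ne j
    simpa [splitEdge, collapse_redirect] using congrArg (X.collapse x) h2

end WGraph

/-- The instance of `k`-SiSP asking for the shortest simple paths from `x₀` to `x₁`. -/
def KSiSCInst.sampled (I : KSiSCInst) (i : ℕ) : KSiSPInst where
  X := I.X.split I.x i
  k := I.k
  k_pos := I.k_pos
  s := (I.x.castSucc : Fin (I.X.n + 1))
  t := Fin.last I.X.n
  s_ne_t := (Fin.castSucc_lt_last I.x).ne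

/-! A simple cycle through `x` has exactly two edges at `x`, and they lead to distinct neighbours
`y` and `z`. All labels are below `2 ^ N` with `N = Nat.clog 2 n`, so `y` and `z` differ in some bit
`i < N`. In `G_i` these two edges hang on different copies of `x`, and the cycle opens into a simple
path from `x₀` to `x₁` (`exists_toCycle`). Conversely, each such path closes to a simple cycle when
the copies are identified (`isCycle_closedWalk`). The neighbour with bit `0` sits next to `x₀`,
which fixes the direction of traversal. Hence the paths of `G_i` correspond bijectively, with equal
weight, to the edge sets of the cycles whose neighbours of `x` differ in bit `i`.

A cycle shows up in `G_i` for every bit in which `y` and `z` differ; it is kept only for the lowest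
one. This is a comparison of two residues modulo `2 ^ (i + 1)` (`SplitPath.isLowest_words`), so
cycles never have to be compared with each other. The list of the `k` lightest cycles so far is
merged with the surviving new ones and cut after `k`. Discarding repetitions may leave fewer than
`k` new cycles, but a discarded cycle missing from the current list was already beaten by `k` cycles
that are no heavier, so nothing is lost (`LightestIn.merge`).

For the running time, the subroutine spends a step on each output word, so copying, weighing and
filtering its output costs a constant times its own time `T`. Weights are read from an adjacency
matrix of which only the `2m` relevant cells are ever written. Merging moves addresses of stored
paths, not the paths, so it costs the number of paths listed. The current list has at most `k` paths
and at most `N * T` words (`program_halts`). The bound `N * T` is free of `k` and gives the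
estimates for arbitrary time bounds; the bound `k` gives the estimate for the concrete subroutine.
-/

/-! ### Assigned locations and frames -/

/-- The integer variables that a program may assign. -/
def Prog.vars : Prog → List ℕ
  | .setVar x _ => [x]
  | .seq c₁ c₂ => c₁.vars ++ c₂.vars
  | .ite _ c₁ c₂ => c₁.vars ++ c₂.vars
  | .while _ c => c.vars
  | .call _ _ _ _ _ x => [x]
  | _ => []

/-- The integer arrays that a program may assign. -/
def Prog.arrs : Prog → List ℕ
  | .setArr a _ _ => [a]
  | .seq c₁ c₂ => c₁.arrs ++ c₂.arrs
  | .ite _ c₁ c₂ => c₁.arrs ++ c₂.arrs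
  | .while _ c => c.arrs
  | .call _ _ _ _ r _ => [r]
  | _ => []

/-- The real arrays that a program may assign. -/
def Prog.reals : Prog → List ℕ
  | .setWts b _ _ => [b]
  | .seq c₁ c₂ => c₁.reals ++ c₂.reals
  | .ite _ c₁ c₂ => c₁.reals ++ c₂.reals
  | .while _ c => c.reals
  | _ => []

/-- `σ'` differs from `σ` only in locations that `c` may assign. -/
structure Frame (c : Prog) (σ σ' : Store) : Prop where
  var : ∀ x, x ∉ c.vars → σ'.var x = σ.var x
  arr : ∀ a, a ∉ c.arrs → σ'.arr a = σ.arr a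
  wts : ∀ b, b ∉ c.reals → σ'.wts b = σ.wts b

namespace Store

@[simp] theorem setVar_var (σ : Store) (x v y : ℕ) :
    (σ.setVar x v).var y = if y = x then v else σ.var y := by
  simp [setVar, Function.update_apply]

@[simp] theorem setVar_arr (σ : Store) (x v : ℕ) : (σ.setVar x v).arr = σ.arr := rfl

@[simp] theorem setVar_wts (σ : Store) (x v : ℕ) : (σ.setVar x v).wts = σ.wts := rfl

@[simp] theorem setArr_var (σ : Store) (a i v : ℕ) : (σ.setArr a i v).var = σ.var := rfl

@[simp] theorem setArr_arr (σ : Store) (a i v b : ℕ) :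
    (σ.setArr a i v).arr b = if b = a then Function.update (σ.arr a) i v else σ.arr b := by
  simp [setArr, Function.update_apply]

@[simp] theorem setArr_wts (σ : Store) (a i v : ℕ) : (σ.setArr a i v).wts = σ.wts := rfl

@[simp] theorem setWts_var (σ : Store) (a i : ℕ) (v : ℝ) : (σ.setWts a i v).var = σ.var := rfl

@[simp] theorem setWts_arr (σ : Store) (a i : ℕ) (v : ℝ) : (σ.setWts a i v).arr = σ.arr := rfl

@[simp] theorem setWts_wts (σ : Store) (a i : ℕ) (v : ℝ) (b : ℕ) :
    (σ.setWts a i v).wts b = if b = a then Function.update (σ.wts a) i v else σ.wts b := by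
  simp [setWts, Function.update_apply]

@[simp] theorem putArr_var (σ : Store) (a : ℕ) (l : List ℕ) : (σ.putArr a l).var = σ.var := rfl

@[simp] theorem putArr_arr (σ : Store) (a : ℕ) (l : List ℕ) (b : ℕ) :
    (σ.putArr a l).arr b = if b = a then fun i => (l[i]?).getD (σ.arr a i) else σ.arr b := by
  simp [putArr, Function.update_apply]

@[simp] theorem putArr_wts (σ : Store) (a : ℕ) (l : List ℕ) : (σ.putArr a l).wts = σ.wts := rfl

end Store

theorem Frame.refl (c : Prog) (σ : Store) : Frame c σ σ :=
  ⟨fun _ _ => rfl, fun _ _ => rfl, fun _ _ => rfl⟩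

theorem Frame.trans {c : Prog} {σ₁ σ₂ σ₃ : Store} (h : Frame c σ₁ σ₂) (h' : Frame c σ₂ σ₃) :
    Frame c σ₁ σ₃ :=
  ⟨fun x hx => (h'.var x hx).trans (h.var x hx), fun x hx => (h'.arr x hx).trans (h.arr x hx),
    fun x hx => (h'.wts x hx).trans (h.wts x hx)⟩

theorem Frame.mono {c c' : Prog} {σ σ' : Store} (h : Frame c σ σ') (hv : c.vars ⊆ c'.vars)
    (ha : c.arrs ⊆ c'.arrs) (hr : c.reals ⊆ c'.reals) : Frame c' σ σ' :=
  ⟨fun x hx => h.var x fun k => hx (hv k), fun x hx => h.arr x fun k => hx (ha k),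
    fun x hx => h.wts x fun k => hx (hr k)⟩

/-- The lists of assigned locations are computed from the program text, so each later claim that a
part of the program leaves some location alone is settled by `decide`. -/
theorem Exec.frame {O : Algo} {c : Prog} {σ σ' : Store} {t : ℕ} {q : List Input}
    (h : Exec O c σ σ' t q) : Frame c σ σ' := by
  induction h with
  | skip σ => exact .refl _ _
  | setVar x e σ =>
    exact ⟨fun y hy => by simp_all [Prog.vars], fun _ _ => rfl, fun _ _ => rfl⟩
  | setArr a i e σ =>
    exact ⟨fun _ _ => rfl, fun y hy => by simp_all [Prog.arrs], fun _ _ => rfl⟩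
  | setWts b i r σ =>
    exact ⟨fun _ _ => rfl, fun _ _ => rfl, fun y hy => by simp_all [Prog.reals]⟩
  | seq _ _ ih₁ ih₂ =>
    exact (ih₁.mono (by simp [Prog.vars]) (by simp [Prog.arrs]) (by simp [Prog.reals])).trans
      (ih₂.mono (by simp [Prog.vars]) (by simp [Prog.arrs]) (by simp [Prog.reals]))
  | iteTrue _ _ ih =>
    exact ih.mono (by simp [Prog.vars]) (by simp [Prog.arrs]) (by simp [Prog.reals])
  | iteFalse _ _ ih =>
    exact ih.mono (by simp [Prog.vars]) (by simp [Prog.arrs]) (by simp [Prog.reals])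
  | whileFalse _ => exact .refl _ _
  | whileTrue _ _ _ ih₁ ih₂ => exact (ih₁.mono (by simp [Prog.vars]) (by simp [Prog.arrs])
      (by simp [Prog.reals])).trans ih₂
  | call _ =>
    exact ⟨fun y hy => by simp_all [Prog.vars], fun y hy => by simp_all [Prog.arrs],
      fun _ _ => rfl⟩

/-! ### Total correctness with running times -/

/-- Started in `σ`, the program `c` halts without calling the subroutine, and the final store and
the number of steps satisfy `Q`. -/
def Runs (O : Algo) (c : Prog) (σ : Store) (Q : Store → ℕ → Prop) : Prop :=
  ∃ σ' t, Exec O c σ σ' t [] ∧ Q σ' t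

section Rules

variable {O : Algo} {σ : Store} {Q Q' : Store → ℕ → Prop} {c c₁ c₂ : Prog}

/-- The frame comes for free with every execution, so the specification of a part of the program
only has to mention what that part changes. -/
theorem Runs.mono_frame (h : Runs O c σ Q') (hQ : ∀ σ' t, Frame c σ σ' → Q' σ' t → Q σ' t) :
    Runs O c σ Q := by
  obtain ⟨σ', t, he, hq⟩ := h
  exact ⟨σ', t, he, hQ _ _ he.frame hq⟩

theorem Runs.mono (h : Runs O c σ Q') (hQ : ∀ σ' t, Q' σ' t → Q σ' t) : Runs O c σ Q :=
  h.mono_frame fun _ _ _ => hQ _ _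

theorem runs_skip : Q σ 1 → Runs O .skip σ Q := fun h => ⟨_, _, .skip _, h⟩

theorem runs_setVar {x : ℕ} {e : NExpr} : Q (σ.setVar x (e.eval σ)) 1 → Runs O (.setVar x e) σ Q :=
  fun h => ⟨_, _, .setVar _ _ _, h⟩

theorem runs_setArr {a : ℕ} {i e : NExpr} :
    Q (σ.setArr a (i.eval σ) (e.eval σ)) 1 → Runs O (.setArr a i e) σ Q :=
  fun h => ⟨_, _, .setArr _ _ _ _, h⟩

theorem runs_setWts {b : ℕ} {i : NExpr} {r : RExpr} :
    Q (σ.setWts b (i.eval σ) (r.eval σ)) 1 → Runs O (.setWts b i r) σ Q :=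
  fun h => ⟨_, _, .setWts _ _ _ _, h⟩

theorem runs_seq (h : Runs O c₁ σ fun σ' t => Runs O c₂ σ' fun σ'' t' => Q σ'' (t + t')) :
    Runs O (.seq c₁ c₂) σ Q := by
  obtain ⟨σ', t, h₁, σ'', t', h₂, hQ⟩ := h
  exact ⟨_, _, .seq h₁ h₂, hQ⟩

theorem runs_ite {b : Test} (h₁ : b.holds σ → Runs O c₁ σ fun σ' t => Q σ' (t + 1))
    (h₂ : ¬ b.holds σ → Runs O c₂ σ fun σ' t => Q σ' (t + 1)) : Runs O (.ite b c₁ c₂) σ Q := by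
  by_cases hb : b.holds σ
  · obtain ⟨σ', t, h, hQ⟩ := h₁ hb
    exact ⟨_, _, .iteTrue hb h, hQ⟩
  · obtain ⟨σ', t, h, hQ⟩ := h₂ hb
    exact ⟨_, _, .iteFalse hb h, hQ⟩

end Rules

/-- `e₁ < e₂` -/
abbrev Test.lt (e₁ e₂ : NExpr) : Test := .not (.le e₂ e₁)

/-- `e₁ = e₂` -/
abbrev Test.eq (e₁ e₂ : NExpr) : Test := .and (.le e₁ e₂) (.le e₂ e₁)

/-- Run `c` for the values `0, …, N - 1` of the variable `i`. -/
def Prog.for (i : ℕ) (N : NExpr) (c : Prog) : Prog :=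
  .seq (.setVar i (.const 0))
    (.while (.lt (.var i) N) (.seq c (.setVar i (.add (.var i) (.const 1)))))

/-- The bound `N` is evaluated anew at every test, hence `hN` asks for its value in all stores that
the loop may reach. Each round pays for one test and one increment besides the body; the final `+ 2`
is the initial assignment and the failing last test. -/
theorem Runs.for {O : Algo} {σ₀ : Store} {i : ℕ} {N : NExpr} {c : Prog} (K : ℕ) (τ : ℕ → ℕ)
    (Inv : ℕ → Store → Prop) (hi : i ∉ c.vars)
    (hN : ∀ σ, Frame (.for i N c) σ₀ σ → N.eval σ = K)
    (h0 : Inv 0 (σ₀.setVar i 0))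
    (step : ∀ j < K, ∀ σ, Frame (.for i N c) σ₀ σ → σ.var i = j → Inv j σ →
      Runs O c σ fun σ' t => Inv (j + 1) (σ'.setVar i (j + 1)) ∧ t ≤ τ j) :
    Runs O (.for i N c) σ₀ fun σ' t => Frame (.for i N c) σ₀ σ' ∧ Inv K σ' ∧
      t ≤ (∑ j ∈ Finset.range K, (τ j + 2)) + 2 := by
  -- Induction on the number `d` of remaining rounds. The cost of the finished rounds is added on
  -- the left, which avoids subtraction.
  have key : ∀ d j, j + d = K → ∀ σ, Frame (.for i N c) σ₀ σ → σ.var i = j → Inv j σ →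
      ∃ σ' t, Exec O (.while (.lt (.var i) N) (.seq c (.setVar i (.add (.var i) (.const 1)))))
        σ σ' t [] ∧ Inv K σ' ∧
        t + ∑ j ∈ Finset.range j, (τ j + 2) ≤ (∑ j ∈ Finset.range K, (τ j + 2)) + 1 := by
    intro d
    induction d with
    | zero =>
      intro j hj σ hF hv hI
      obtain rfl : j = K := by omega
      refine ⟨σ, 1, .whileFalse ?_, hI, by omega⟩
      simp [Test.holds, NExpr.eval, hv, hN σ hF]
    | succ d ih =>
      intro j hj σ hF hv hI
      obtain ⟨σ', t, he, hI', ht⟩ := step j (by omega) σ hF hv hI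
      have hv' : σ'.var i = j := (he.frame.var i hi).trans hv
      have he2 : Exec O (.setVar i (.add (.var i) (.const 1))) σ' (σ'.setVar i (j + 1)) 1 [] := by
        have := Exec.setVar (O := O) i (.add (.var i) (.const 1)) σ'
        simpa [NExpr.eval, hv'] using this
      have he3 := Exec.seq he he2
      have hF' : Frame (.for i N c) σ₀ (σ'.setVar i (j + 1)) :=
        hF.trans (he3.frame.mono (by simp [Prog.vars, Prog.for]) (by simp [Prog.arrs, Prog.for])
          (by simp [Prog.reals, Prog.for]))
      obtain ⟨σ'', t', hw, hK, ht'⟩ := ih (j + 1) (by omega) _ hF' (by simp) hI'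
      refine ⟨σ'', _, .whileTrue ?_ he3 hw, hK, ?_⟩
      · simp only [Test.holds, NExpr.eval, hv, hN σ hF]; omega
      · rw [Finset.sum_range_succ] at ht'
        omega
  have hF0 : Frame (.for i N c) σ₀ (σ₀.setVar i 0) :=
    ⟨fun y hy => by simp_all [Prog.vars, Prog.for], fun _ _ => rfl, fun _ _ => rfl⟩
  obtain ⟨σ', t, he, hI, ht⟩ := key K 0 (by omega) _ hF0 (by simp) h0
  have hall : Exec O (.for i N c) σ₀ σ' (1 + t) ([] ++ []) :=
    Exec.seq (Exec.setVar i (.const 0) σ₀) he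
  exact ⟨σ', 1 + t, hall, hall.frame, hI, by simp at ht; omega⟩

/-- Loops whose body takes at most `τ` steps. -/
theorem Runs.for_const {O : Algo} {σ₀ : Store} {i : ℕ} {N : NExpr} {c : Prog} (K τ : ℕ)
    (Inv : ℕ → Store → Prop) (hi : i ∉ c.vars)
    (hN : ∀ σ, Frame (.for i N c) σ₀ σ → N.eval σ = K)
    (h0 : Inv 0 (σ₀.setVar i 0))
    (step : ∀ j < K, ∀ σ, Frame (.for i N c) σ₀ σ → σ.var i = j → Inv j σ →
      Runs O c σ fun σ' t => Inv (j + 1) (σ'.setVar i (j + 1)) ∧ t ≤ τ) :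
    Runs O (.for i N c) σ₀ fun σ' t => Frame (.for i N c) σ₀ σ' ∧ Inv K σ' ∧
      t ≤ (τ + 2) * K + 2 := by
  refine (Runs.for K (fun _ => τ) Inv hi hN h0 step).mono ?_
  rintro σ' t ⟨h1, h2, h3⟩
  exact ⟨h1, h2, by simpa [mul_comm] using h3⟩

/-! ### Words stored in arrays -/

/-- The words of `l` are stored in `f` from the address `a` on. -/
def Seg (f : ℕ → ℕ) : ℕ → List ℕ → Prop
  | _, [] => True
  | a, v :: l => f a = v ∧ Seg f (a + 1) l

@[simp] theorem seg_nil (f : ℕ → ℕ) (a : ℕ) : Seg f a [] := trivial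

@[simp] theorem seg_cons (f : ℕ → ℕ) (a v : ℕ) (l : List ℕ) :
    Seg f a (v :: l) ↔ f a = v ∧ Seg f (a + 1) l := Iff.rfl

theorem seg_append {f : ℕ → ℕ} {a : ℕ} {l l' : List ℕ} :
    Seg f a (l ++ l') ↔ Seg f a l ∧ Seg f (a + l.length) l' := by
  induction l generalizing a with
  | nil => simp
  | cons v l ih =>
    simp only [List.cons_append, seg_cons, ih, List.length_cons, and_assoc]
    rw [show a + 1 + l.length = a + (l.length + 1) by omega]

theorem Seg.congr {f g : ℕ → ℕ} {a : ℕ} {l : List ℕ} (h : Seg f a l)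
    (hg : ∀ i, a ≤ i → i < a + l.length → g i = f i) : Seg g a l := by
  induction l generalizing a with
  | nil => trivial
  | cons v l ih =>
    refine ⟨(hg a le_rfl (by simp)).trans h.1, ih h.2 fun i hi hi' => hg i (by omega) ?_⟩
    simp only [List.length_cons]; omega

theorem Seg.get {f : ℕ → ℕ} {a : ℕ} {l : List ℕ} (h : Seg f a l) {j : ℕ} (hj : j < l.length) :
    f (a + j) = l.getD j 0 := by
  induction l generalizing a j with
  | nil => simp at hj
  | cons v l ih =>
    cases j with
    | zero => simpa using h.1
    | succ j =>
      simp only [List.length_cons] at hj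
      rw [show a + (j + 1) = a + 1 + j by omega, ih h.2 (by omega)]
      simp

theorem seg_of_get {f : ℕ → ℕ} {a : ℕ} {l : List ℕ}
    (h : ∀ j < l.length, f (a + j) = l.getD j 0) : Seg f a l := by
  induction l generalizing a with
  | nil => trivial
  | cons v l ih =>
    refine ⟨by simpa using h 0 (by simp), ih fun j hj => ?_⟩
    have := h (j + 1) (by simpa using hj)
    rw [show a + (j + 1) = a + 1 + j by omega] at this
    simpa using this

theorem Seg.map_range {f : ℕ → ℕ} {l : List ℕ} (h : Seg f 0 l) :
    (List.range l.length).map f = l := by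
  refine List.ext_getElem (by simp) fun i h1 h2 => ?_
  have := h.get h2
  simp only [zero_add] at this
  simp [this, h2]

/-- Appending a word. -/
theorem Seg.snoc {f : ℕ → ℕ} {a : ℕ} {l : List ℕ} (h : Seg f a l) (v : ℕ) :
    Seg (Function.update f (a + l.length) v) a (l ++ [v]) := by
  refine seg_append.2 ⟨h.congr fun i _ hi => Function.update_of_ne (by omega) _ _, ?_⟩
  simp

/-! ### The reduction

Integer variables: `1`–`4` hold `n`, `m`, `k`, `x`; `5` holds `2 ^ i`; `6` is the first unused
address of the path storage; `7` and `8` are the lengths of the lists `6` and `5` of paths;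
`9`, `10` are loop counters and `11`–`16` are auxiliary.

Integer arrays: `0` is the input, `1` the output, `2` the input and `3` the output of the
subroutine, `4` the path storage, `5` the addresses of the new paths, `6` the addresses of the
lightest paths so far, `7` the merged list; `8` contains the multiples of `n`, `9` the map that
identifies the two copies of `x`, and `10` the residues modulo `2 ^ (i + 1)`.

Real arrays: `0` is the input, `1` the weighted adjacency matrix, `2` the weights of the paths. -/

namespace CycleReduction

local infixl:65 " ⊹ " => NExpr.add
local infixr:30 " ;; " => Prog.seq

/-- Read the header of the input. -/
def readHeader : Prog :=
  .setVar 1 (.arr 0 (.const 0)) ;; .setVar 2 (.arr 0 (.const 1)) ;;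
  .setVar 3 (.arr 0 (.const 2)) ;; .setVar 4 (.arr 0 (.const 3))

/-- Tabulate the multiples of `n` and the map that identifies the two copies of `x`. -/
def makeTables : Prog :=
  .setVar 11 (.const 0) ;;
  .for 9 (.var 1) (
    .setArr 8 (.var 9) (.var 11) ;; .setArr 9 (.var 9) (.var 9) ;;
    .setVar 11 (.var 11 ⊹ .var 1)) ;;
  .setArr 9 (.var 1) (.var 4)

/-- The first endpoint of the edge counted by the variable `9`. -/
def fstEnd : NExpr := .arr 0 (.const 4 ⊹ (.var 9 ⊹ .var 9))

/-- The second endpoint of the edge counted by the variable `9`. -/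
def sndEnd : NExpr := .arr 0 (.const 5 ⊹ (.var 9 ⊹ .var 9))

/-- Write the weighted adjacency matrix. -/
def makeMatrix : Prog :=
  .for 9 (.var 2) (
    .setWts 1 (.arr 8 fstEnd ⊹ sndEnd) (.wts 0 (.var 9)) ;;
    .setWts 1 (.arr 8 sndEnd ⊹ fstEnd) (.wts 0 (.var 9)))

/-- Tabulate the residues modulo `2 ^ (i + 1)`. -/
def makeResidues : Prog :=
  .setVar 11 (.const 0) ;;
  .for 9 (.var 1) (
    .setArr 10 (.var 9) (.var 11) ;; .setVar 11 (.var 11 ⊹ .const 1) ;;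
    .ite (.le (.var 5 ⊹ .var 5) (.var 11)) (.setVar 11 (.const 0)) .skip)

/-- Write the header of the bit-sampled instance. -/
def writeHeader : Prog :=
  .setArr 2 (.const 0) (.var 1 ⊹ .const 1) ;; .setArr 2 (.const 1) (.var 2) ;;
  .setArr 2 (.const 2) (.var 3) ;; .setArr 2 (.const 3) (.var 4) ;;
  .setArr 2 (.const 4) (.var 1)

/-- Write the bit-sampled instance. -/
def makeSplit : Prog :=
  writeHeader ;;
  .for 9 (.var 2) (
    .ite (.and (.eq fstEnd (.var 4)) (.le (.var 5) (.arr 10 sndEnd)))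
      (.setArr 2 (.const 5 ⊹ (.var 9 ⊹ .var 9)) (.var 1))
      (.setArr 2 (.const 5 ⊹ (.var 9 ⊹ .var 9)) fstEnd) ;;
    .ite (.and (.eq sndEnd (.var 4)) (.le (.var 5) (.arr 10 fstEnd)))
      (.setArr 2 (.const 6 ⊹ (.var 9 ⊹ .var 9)) (.var 1))
      (.setArr 2 (.const 6 ⊹ (.var 9 ⊹ .var 9)) sndEnd))

/-- Copy the output of the subroutine to the path storage. -/
def copyResult : Prog :=
  .for 9 (.var 12) (.setArr 4 (.var 6 ⊹ .var 9) (.arr 3 (.var 9)))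

/-- Compute the weight of the path at the address in the variable `13`. -/
def weigh : Prog :=
  .setWts 2 (.var 13) .zero ;;
  .for 10 (.sub (.var 14) (.const 1))
    (.setWts 2 (.var 13) (.add (.wts 2 (.var 13))
      (.wts 1 (.arr 8 (.arr 9 (.arr 4 (.var 13 ⊹ .const 1 ⊹ .var 10))) ⊹
        .arr 9 (.arr 4 (.var 13 ⊹ .const 2 ⊹ .var 10))))))

/-- Weigh the new paths and list those whose ends have labels that agree in the bits below `i`. -/
def parse : Prog :=
  .setVar 8 (.const 0) ;; .setVar 13 (.var 6 ⊹ .const 1) ;;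
  .for 9 (.arr 4 (.var 6)) (
    .setVar 14 (.arr 4 (.var 13)) ;; weigh ;;
    .ite (.eq (.arr 10 (.arr 4 (.sub (.var 13 ⊹ .var 14) (.const 1))))
        (.arr 10 (.arr 4 (.var 13 ⊹ .const 2)) ⊹ .var 5))
      (.setArr 5 (.var 8) (.var 13) ;; .setVar 8 (.var 8 ⊹ .const 1)) .skip ;;
    .setVar 13 (.var 13 ⊹ .var 14 ⊹ .const 1)) ;;
  .setVar 6 (.var 6 ⊹ .var 12)

/-- Merge the new paths with the lightest paths so far. -/
def mergeLists : Prog :=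
  .setVar 15 (.const 0) ;; .setVar 16 (.const 0) ;;
  .for 9 (.var 7 ⊹ .var 8) (
    .ite (.and (.lt (.var 15) (.var 7))
        (.not (.and (.lt (.var 16) (.var 8))
          (.not (.rle (.wts 2 (.arr 6 (.var 15))) (.wts 2 (.arr 5 (.var 16))))))))
      (.setArr 7 (.var 9) (.arr 6 (.var 15)) ;; .setVar 15 (.var 15 ⊹ .const 1))
      (.setArr 7 (.var 9) (.arr 5 (.var 16)) ;; .setVar 16 (.var 16 ⊹ .const 1)))

/-- Keep the first `k` paths of the merged list. -/
def truncate : Prog :=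
  .ite (.le (.var 7 ⊹ .var 8) (.var 3)) (.setVar 7 (.var 7 ⊹ .var 8)) (.setVar 7 (.var 3)) ;;
  .for 9 (.var 7) (.setArr 6 (.var 9) (.arr 7 (.var 9)))

/-- Write the path counted by the variable `9` to the output. -/
def writePath : Prog :=
  .setVar 13 (.arr 6 (.var 9)) ;; .setVar 14 (.arr 4 (.var 13)) ;;
  .setArr 1 (.var 11) (.var 14) ;; .setVar 11 (.var 11 ⊹ .const 1) ;;
  .for 10 (.var 14)
    (.setArr 1 (.var 11 ⊹ .var 10) (.arr 9 (.arr 4 (.var 13 ⊹ .const 1 ⊹ .var 10)))) ;;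
  .setVar 11 (.var 11 ⊹ .var 14)

/-- Write the output. -/
def writeOutput : Prog :=
  .setArr 1 (.const 0) (.var 7) ;; .setVar 11 (.const 1) ;;
  .for 9 (.var 7) writePath ;; .setVar 0 (.var 11)

def setup : Prog := readHeader ;; makeTables ;; makeMatrix ;; .setVar 5 (.const 1)

def beforeCall : Prog := makeResidues ;; makeSplit

def theCall : Prog :=
  .call 2 (.const 5 ⊹ (.var 2 ⊹ .var 2)) 0 (.var 2) 3 12

def afterCall : Prog :=
  copyResult ;; parse ;; mergeLists ;; truncate ;; .setVar 5 (.var 5 ⊹ .var 5)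

def round : Prog := beforeCall ;; theCall ;; afterCall

/-- The reduction from `k`-SiSC to `k`-SiSP. -/
def program : Prog := setup ;; .while (.lt (.var 5) (.var 1)) round ;; writeOutput

/-! ### Correctness of the parts of the program -/

/-- Identify the two copies `x` and `n` of `x`. -/
def coll (n x w : ℕ) : ℕ := if w = n then x else w

/-- The machine cannot multiply, so the multiples of `n` are accumulated by addition. The table of
labels is first the identity; its entry at `n` is set to `x` at the end. -/
theorem makeTables_runs {O : Algo} {σ : Store} {n x : ℕ} (hn : σ.var 1 = n) (hx : σ.var 4 = x) :
    Runs O makeTables σ fun σ' t => (∀ u < n, σ'.arr 8 u = u * n) ∧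
      (∀ u ≤ n, σ'.arr 9 u = coll n x u) ∧ t ≤ 5 * n + 4 := by
  refine runs_seq (runs_setVar (runs_seq ((Runs.for_const n 3
    (fun j σ' => σ'.var 11 = j * n ∧ (∀ u < j, σ'.arr 8 u = u * n) ∧ ∀ u < j, σ'.arr 9 u = u)
    (by decide) ?_ ?_ ?_).mono ?_)))
  · intro σ' hF
    simpa [NExpr.eval, hn] using hF.var 1 (by decide)
  · simp [NExpr.eval]
  · rintro j hj σ' hF hv ⟨h1, h2, h3⟩
    have hn' : σ'.var 1 = n := (hF.var 1 (by decide)).trans (by simp [hn])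
    refine runs_seq (runs_setArr (runs_seq (runs_setArr (runs_setVar ?_))))
    simp only [NExpr.eval, hv, h1]
    refine ⟨⟨by simp [h1, hn', add_mul], fun u hu => ?_, fun u hu => ?_⟩, by omega⟩
    · by_cases huj : u = j
      · simp [huj]
      · simpa [huj] using h2 u (by omega)
    · by_cases huj : u = j
      · simp [huj, hv]
      · simpa [huj, hv] using h3 u (by omega)
  · rintro σ' t ⟨hF, ⟨-, h2, h3⟩, ht⟩
    have hn' : σ'.var 1 = n := (hF.var 1 (by decide)).trans (by simp [hn])
    have hx' : σ'.var 4 = x := (hF.var 4 (by decide)).trans (by simp [hx])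
    refine runs_setArr ⟨by simpa using h2, fun u hu => ?_, by omega⟩
    by_cases hun : u = n
    · simp [NExpr.eval, hn', hx', hun, coll]
    · simpa [NExpr.eval, hn', hun, coll] using h3 u (by omega)

/-- Only two cells per edge are written; the rest of the matrix is never initialised, which keeps
the cost linear in `m`. The invariant concerns the pairs that have occurred as edges so far: by
uniqueness of `u * n + v`, a cell is only ever overwritten for the same pair, and then with the same
weight. -/
theorem makeMatrix_runs {O : Algo} {σ : Store} {n m : ℕ} {e₁ e₂ : ℕ → ℕ} {ω : ℕ → ℕ → ℝ}
    (hm : σ.var 2 = m) (hmul : ∀ u < n, σ.arr 8 u = u * n)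
    (h₁ : ∀ j < m, σ.arr 0 (4 + (j + j)) = e₁ j) (h₂ : ∀ j < m, σ.arr 0 (5 + (j + j)) = e₂ j)
    (hw : ∀ j < m, σ.wts 0 j = ω (e₁ j) (e₂ j)) (hω : ∀ u v, ω u v = ω v u)
    (he₁ : ∀ j < m, e₁ j < n) (he₂ : ∀ j < m, e₂ j < n) :
    Runs O makeMatrix σ fun σ' t => (∀ j < m, σ'.wts 1 (e₁ j * n + e₂ j) = ω (e₁ j) (e₂ j) ∧
      σ'.wts 1 (e₂ j * n + e₁ j) = ω (e₁ j) (e₂ j)) ∧ t ≤ 4 * m + 2 := by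
  refine (Runs.for_const m 2 (fun J σ' => ∀ u < n, ∀ v < n, (∃ j < J, (u = e₁ j ∧ v = e₂ j) ∨
    (u = e₂ j ∧ v = e₁ j)) → σ'.wts 1 (u * n + v) = ω u v) (by decide) ?_ ?_ ?_).mono ?_
  · intro σ' hF
    simpa [NExpr.eval, hm] using hF.var 2 (by decide)
  · simp
  · rintro j hj σ' hF hv hI
    have hA : σ'.arr 0 = σ.arr 0 := hF.arr 0 (by decide)
    have hM : σ'.arr 8 = σ.arr 8 := hF.arr 8 (by decide)
    have hW : σ'.wts 0 = σ.wts 0 := hF.wts 0 (by decide)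
    refine runs_seq (runs_setWts (runs_setWts ⟨?_, by omega⟩))
    simp only [NExpr.eval, RExpr.eval, fstEnd, sndEnd, hv, hA, hM, h₁ j hj, h₂ j hj, hW, hw j hj,
      Store.setWts_var, Store.setWts_arr, Store.setWts_wts, hmul _ (he₁ j hj), hmul _ (he₂ j hj),
      Store.setVar_wts, if_true, zero_ne_one, if_false]
    have inj : ∀ u < n, ∀ v < n, ∀ u' < n, ∀ v' < n, u * n + v = u' * n + v' →
        u = u' ∧ v = v' := by
      intro u hu v hv u' hu' v' hv' h
      have h1 := congrArg (· % n) h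
      simp [Nat.mod_eq_of_lt hv, Nat.mod_eq_of_lt hv'] at h1
      subst h1
      exact ⟨Nat.eq_of_mul_eq_mul_right (by omega) (by omega : u * n = u' * n), rfl⟩
    intro u hu v hv' hj'
    -- The second write is examined first, as it would override the first one.
    by_cases hc2 : u * n + v = e₂ j * n + e₁ j
    · obtain ⟨rfl, rfl⟩ := inj u hu v hv' _ (he₂ j hj) _ (he₁ j hj) hc2
      simp [hω]
    by_cases hc1 : u * n + v = e₁ j * n + e₂ j
    · obtain ⟨rfl, rfl⟩ := inj u hu v hv' _ (he₁ j hj) _ (he₂ j hj) hc1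
      rw [Function.update_of_ne hc2, Function.update_self]
    rw [Function.update_of_ne hc2, Function.update_of_ne hc1]
    refine hI u hu v hv' ?_
    obtain ⟨j', hj', h⟩ := hj'
    refine ⟨j', ?_, h⟩
    rcases Nat.lt_succ_iff_lt_or_eq.1 hj' with h' | rfl
    · exact h'
    · rcases h with ⟨rfl, rfl⟩ | ⟨rfl, rfl⟩
      · exact absurd rfl hc1
      · exact absurd rfl hc2
  · rintro σ' t ⟨-, h, ht⟩
    refine ⟨fun j hj => ⟨h _ (he₁ j hj) _ (he₂ j hj) ⟨j, hj, .inl ⟨rfl, rfl⟩⟩, ?_⟩, ht⟩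
    rw [h _ (he₂ j hj) _ (he₁ j hj) ⟨j, hj, .inr ⟨rfl, rfl⟩⟩, hω]

/-- Division is not available either: the residue is a counter that returns to `0` on reaching `p +
p`. -/
theorem makeResidues_runs {O : Algo} {σ : Store} {n p : ℕ} (hn : σ.var 1 = n) (hp : σ.var 5 = p)
    (hp0 : 0 < p) :
    Runs O makeResidues σ fun σ' t => (∀ y < n, σ'.arr 10 y = y % (p + p)) ∧ t ≤ 6 * n + 3 := by
  refine runs_seq (runs_setVar ((Runs.for_const n 4
    (fun j σ' => σ'.var 11 = j % (p + p) ∧ ∀ y < j, σ'.arr 10 y = y % (p + p))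
    (by decide) ?_ ?_ ?_).mono ?_))
  · intro σ' hF
    simpa [NExpr.eval, hn] using hF.var 1 (by decide)
  · simp [NExpr.eval]
  · rintro j hj σ' hF hv ⟨h1, h2⟩
    have hp' : σ'.var 5 = p := (hF.var 5 (by decide)).trans (by simp [hp])
    have hlt : j % (p + p) < p + p := Nat.mod_lt _ (by omega)
    have hB : ∀ y < j + 1, Function.update (σ'.arr 10) j (j % (p + p)) y = y % (p + p) := by
      intro y hy
      by_cases hyj : y = j
      · simp [hyj]
      · rw [Function.update_of_ne hyj, h2 y (by omega)]
    refine runs_seq (runs_setArr (runs_seq (runs_setVar (runs_ite (fun h => runs_setVar ?_)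
      fun h => runs_skip ?_))))
    · simp [Test.holds, NExpr.eval, hv, h1, hp'] at h
      refine ⟨⟨?_, by simpa [NExpr.eval, hv, h1] using hB⟩, by omega⟩
      have : j % (p + p) + 1 = p + p := by omega
      simp [NExpr.eval]
      rw [Nat.add_mod, Nat.mod_eq_of_lt (by omega : 1 < p + p), this, Nat.mod_self]
    · simp [Test.holds, NExpr.eval, hv, h1, hp'] at h
      refine ⟨⟨?_, by simpa [NExpr.eval, hv, h1] using hB⟩, by omega⟩
      simp [NExpr.eval, h1]
      rw [Nat.add_mod, Nat.mod_eq_of_lt (by omega : 1 < p + p), Nat.mod_eq_of_lt h]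
  · rintro σ' t ⟨-, ⟨-, h⟩, ht⟩
    exact ⟨h, by omega⟩

/-- The label that replaces the endpoint `u` of the edge `uv`, where `p = 2 ^ i`. -/
def redirectWord (n x p u v : ℕ) : ℕ := if u = x ∧ p ≤ v % (p + p) then n else u

theorem writeHeader_runs {O : Algo} {σ : Store} {n m k x : ℕ}
    (hn : σ.var 1 = n) (hm : σ.var 2 = m) (hk : σ.var 3 = k) (hx : σ.var 4 = x) :
    Runs O writeHeader σ fun σ' t => Seg (σ'.arr 2) 0 [n + 1, m, k, x, n] ∧ t = 5 := by
  refine runs_seq (runs_setArr (runs_seq (runs_setArr (runs_seq (runs_setArr (runs_seq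
    (runs_setArr (runs_setArr ⟨?_, rfl⟩))))))))
  simp [NExpr.eval, hn, hm, hk, hx]

theorem makeSplit_runs {O : Algo} {σ : Store} {n m k x p : ℕ} {e₁ e₂ : ℕ → ℕ}
    (hn : σ.var 1 = n) (hm : σ.var 2 = m) (hk : σ.var 3 = k) (hx : σ.var 4 = x)
    (hp : σ.var 5 = p) (hres : ∀ y < n, σ.arr 10 y = y % (p + p))
    (h₁ : ∀ j < m, σ.arr 0 (4 + (j + j)) = e₁ j) (h₂ : ∀ j < m, σ.arr 0 (5 + (j + j)) = e₂ j)
    (he₁ : ∀ j < m, e₁ j < n) (he₂ : ∀ j < m, e₂ j < n) :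
    Runs O makeSplit σ fun σ' t => Seg (σ'.arr 2) 0 ([n + 1, m, k, x, n] ++
      (List.range m).flatMap fun j =>
        [redirectWord n x p (e₁ j) (e₂ j), redirectWord n x p (e₂ j) (e₁ j)]) ∧
      t ≤ 6 * m + 7 := by
  refine runs_seq ((writeHeader_runs hn hm hk hx).mono_frame ?_)
  rintro σ₁ _ hF₁ ⟨h₀, rfl⟩
  refine (Runs.for_const m 4
    (fun j σ' => Seg (σ'.arr 2) 0 ([n + 1, m, k, x, n] ++ (List.range j).flatMap fun j =>
        [redirectWord n x p (e₁ j) (e₂ j), redirectWord n x p (e₂ j) (e₁ j)]))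
    (by decide) ?_ ?_ ?_).mono ?_
  · intro σ' hF
    exact ((hF.var 2 (by decide)).trans (hF₁.var 2 (by decide))).trans hm
  · simpa using h₀
  · rintro j hj σ' hF hv hI
    have hA : σ'.arr 0 = σ.arr 0 := (hF.arr 0 (by decide)).trans (hF₁.arr 0 (by decide))
    have hB : σ'.arr 10 = σ.arr 10 := (hF.arr 10 (by decide)).trans (hF₁.arr 10 (by decide))
    have hn' : σ'.var 1 = n := ((hF.var 1 (by decide)).trans (hF₁.var 1 (by decide))).trans hn
    have hx' : σ'.var 4 = x := ((hF.var 4 (by decide)).trans (hF₁.var 4 (by decide))).trans hx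
    have hp' : σ'.var 5 = p := ((hF.var 5 (by decide)).trans (hF₁.var 5 (by decide))).trans hp
    clear hF hF₁
    -- Two words per edge after a header of five words: the next free addresses are `5 + (j + j)`
    -- and `6 + (j + j)`, which are where the program writes.
    have hlen : ∀ j, ((List.range j).flatMap fun j =>
        [redirectWord n x p (e₁ j) (e₂ j), redirectWord n x p (e₂ j) (e₁ j)]).length = j + j := by
      intro j; simp [List.length_flatMap]; omega
    have s1 := hI.snoc (redirectWord n x p (e₁ j) (e₂ j))
    have s2 := s1.snoc (redirectWord n x p (e₂ j) (e₁ j))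
    have l1 : 0 + ([n + 1, m, k, x, n] ++ (List.range j).flatMap fun j =>
        [redirectWord n x p (e₁ j) (e₂ j), redirectWord n x p (e₂ j) (e₁ j)]).length
        = 5 + (j + j) := by
      rw [List.length_append, hlen]; simp
    have l2 : ∀ v, 0 + (([n + 1, m, k, x, n] ++ (List.range j).flatMap fun j =>
        [redirectWord n x p (e₁ j) (e₂ j), redirectWord n x p (e₂ j) (e₁ j)]) ++ [v]).length
        = 6 + (j + j) := by
      intro v; rw [List.length_append, ← add_assoc, l1]; simp; omega
    rw [l1, l2] at s2
    have r1 : Runs O (.ite (.and (.eq fstEnd (.var 4)) (.le (.var 5) (.arr 10 sndEnd)))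
      (.setArr 2 (.const 5 ⊹ (.var 9 ⊹ .var 9)) (.var 1))
      (.setArr 2 (.const 5 ⊹ (.var 9 ⊹ .var 9)) fstEnd)) σ' fun σ'' t =>
        σ'' = σ'.setArr 2 (5 + (j + j)) (redirectWord n x p (e₁ j) (e₂ j)) ∧ t = 2 := by
      refine runs_ite (fun h => runs_setArr ?_) fun h => runs_setArr ?_ <;>
      · simp only [Test.holds, NExpr.eval, fstEnd, sndEnd, hA, hB, hv, h₁ j hj, h₂ j hj, hx', hp',
          hres _ (he₂ j hj), ← le_antisymm_iff] at h
        simp [NExpr.eval, fstEnd, redirectWord, h, hv, hn', hA, h₁ j hj]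
    refine runs_seq (r1.mono ?_)
    rintro _ _ ⟨rfl, rfl⟩
    refine runs_ite (fun h => runs_setArr ?_) fun h => runs_setArr ?_ <;>
    · simp [Test.holds, NExpr.eval, fstEnd, sndEnd, hA, hB, hv, h₁ j hj, h₂ j hj, hx', hp',
          hres _ (he₁ j hj), ← le_antisymm_iff, - not_and] at h
      refine ⟨?_, by omega⟩
      rw [List.range_succ, List.flatMap_append, List.flatMap_singleton, ← List.append_assoc]
      rw [List.append_assoc _ [_] [_], List.singleton_append] at s2
      convert s2 using 1
      simp [NExpr.eval, hv, hn', sndEnd, hA, h₂ j hj, redirectWord, h]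
  · rintro σ' t ⟨-, h, ht⟩
    exact ⟨h, by omega⟩

/-- The next call reuses the result array, so the output is moved behind the paths stored earlier.
Cells below `base` are untouched, and addresses handed out in earlier rounds stay valid. -/
theorem copyResult_runs {O : Algo} {σ : Store} {base : ℕ} {out : List ℕ}
    (hb : σ.var 6 = base) (hlen : σ.var 12 = out.length) (hr : Seg (σ.arr 3) 0 out) :
    Runs O copyResult σ fun σ' t => Seg (σ'.arr 4) base out ∧
      (∀ a < base, σ'.arr 4 a = σ.arr 4 a) ∧ t ≤ 3 * out.length + 2 := by
  refine (Runs.for_const out.length 1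
    (fun j σ' => (∀ a < j, σ'.arr 4 (base + a) = out.getD a 0) ∧
      ∀ a < base, σ'.arr 4 a = σ.arr 4 a) (by decide) ?_ ?_ ?_).mono ?_
  · intro σ' hF
    simpa [NExpr.eval, hlen] using hF.var 12 (by decide)
  · simp
  · rintro j hj σ' hF hv ⟨h1, h2⟩
    have hb' : σ'.var 6 = base := (hF.var 6 (by decide)).trans (by simp [hb])
    have hR : σ'.arr 3 = σ.arr 3 := hF.arr 3 (by decide)
    have := hr.get hj
    rw [zero_add] at this
    refine runs_setArr ⟨⟨fun a ha => ?_, fun a ha => ?_⟩, le_rfl⟩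
    · by_cases haj : a = j
      · simp [NExpr.eval, hb', hv, hR, haj, this]
      · simpa [NExpr.eval, hb', hv, hR, haj] using h1 a (by omega)
    · simpa [NExpr.eval, hb', hv, Function.update_of_ne (by omega : a ≠ base + j)] using h2 a ha
  · rintro σ' t ⟨-, ⟨h1, h2⟩, ht⟩
    exact ⟨seg_of_get h1, h2, by omega⟩

/-- The weight of the walk with the vertex sequence `ws`, where `f` gives the weights of edges. -/
noncomputable def pathWt (f : ℕ → ℕ → ℝ) (ws : List ℕ) : ℝ :=
  ∑ j ∈ Finset.range (ws.length - 1), f (ws.getD j 0) (ws.getD (j + 1) 0)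

/-- The entries of the adjacency matrix `W` with the two copies of `x` identified. -/
def matWt (n x : ℕ) (W : ℕ → ℝ) (u v : ℕ) : ℝ := W (coll n x u * n + coll n x v)

/-- The tables computed in the course of the program. -/
structure Tables (n x p : ℕ) (W : ℕ → ℝ) (σ : Store) : Prop where
  mul : ∀ u < n, σ.arr 8 u = u * n
  cl : ∀ u ≤ n, σ.arr 9 u = coll n x u
  res : ∀ y < n, σ.arr 10 y = y % (p + p)
  pow : σ.var 5 = p
  mat : σ.wts 1 = W

theorem Tables.of_frame {n x p : ℕ} {W : ℕ → ℝ} {σ σ' : Store} (h : Tables n x p W σ)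
    {c : Prog} (hF : Frame c σ σ') (h8 : 8 ∉ c.arrs) (h9 : 9 ∉ c.arrs) (h10 : 10 ∉ c.arrs)
    (h5 : 5 ∉ c.vars) (h1 : 1 ∉ c.reals) : Tables n x p W σ' where
  mul := hF.arr 8 h8 ▸ h.mul
  cl := hF.arr 9 h9 ▸ h.cl
  res := hF.arr 10 h10 ▸ h.res
  pow := hF.var 5 h5 ▸ h.pow
  mat := hF.wts 1 h1 ▸ h.mat

theorem coll_lt {n x w : ℕ} (hx : x < n) (hw : w ≤ n) : coll n x w < n := by
  unfold coll; split_ifs <;> omega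

theorem getD_le {n : ℕ} {ws : List ℕ} (h : ∀ w ∈ ws, w ≤ n) (j : ℕ) : ws.getD j 0 ≤ n := by
  rw [List.getD_eq_getElem?_getD]
  rcases lt_or_ge j ws.length with hj | hj
  · simpa [hj] using h _ (List.getElem_mem hj)
  · simp [hj]

theorem weigh_runs {O : Algo} {σ : Store} {n x p ptr : ℕ} {W : ℕ → ℝ} {ws : List ℕ}
    (hT : Tables n x p W σ) (hx : x < n) (hptr : σ.var 13 = ptr) (hlen : σ.var 14 = ws.length)
    (hseg : Seg (σ.arr 4) (ptr + 1) ws) (hws : ∀ w ∈ ws, w ≤ n) :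
    Runs O weigh σ fun σ' t =>
      σ'.wts 2 = Function.update (σ.wts 2) ptr (pathWt (matWt n x W) ws) ∧
      t ≤ 3 * ws.length + 3 := by
  refine runs_seq (runs_setWts ((Runs.for_const (ws.length - 1) 1
    (fun J σ' => σ'.wts 2 = Function.update (σ.wts 2) ptr
      (∑ j ∈ Finset.range J, matWt n x W (ws.getD j 0) (ws.getD (j + 1) 0)))
    (by decide) ?_ ?_ ?_).mono ?_))
  · intro σ' hF
    have : σ'.var 14 = ws.length := (hF.var 14 (by decide)).trans (by simp [hlen])
    simp [NExpr.eval, this]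
  · simp [RExpr.eval, NExpr.eval, hptr]
  · rintro j hj σ' hF hv hI
    have hptr' : σ'.var 13 = ptr := (hF.var 13 (by decide)).trans (by simp [hptr])
    have h4 : σ'.arr 4 = σ.arr 4 := (hF.arr 4 (by decide)).trans (by simp)
    have h8 : σ'.arr 8 = σ.arr 8 := (hF.arr 8 (by decide)).trans (by simp)
    have h9 : σ'.arr 9 = σ.arr 9 := (hF.arr 9 (by decide)).trans (by simp)
    have hW : σ'.wts 1 = W := (hF.wts 1 (by decide)).trans (by simp [hT.mat])
    have g1 := hseg.get (j := j) (by omega)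
    have g2 := hseg.get (j := j + 1) (by omega)
    rw [show ptr + 1 + (j + 1) = ptr + 2 + j by omega] at g2
    refine runs_setWts ⟨?_, le_rfl⟩
    simp only [NExpr.eval, RExpr.eval, hptr', hv, h4, g1, g2, h9, hT.cl _ (getD_le hws _), h8,
      hT.mul _ (coll_lt hx (getD_le hws _)), hI, hW]
    simp [Finset.sum_range_succ, matWt, hI]
  · rintro σ' t ⟨-, h, ht⟩
    exact ⟨h, by omega⟩

/-- The words of the sequences `L`, each sequence preceded by its length. -/
def encodeAll (L : List (List ℕ)) : List ℕ := L.flatMap fun ws => ws.length :: ws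

theorem encodeSeqs_eq (L : List (List ℕ)) : encodeSeqs L = L.length :: encodeAll L := rfl

theorem encodeAll_append (L L' : List (List ℕ)) :
    encodeAll (L ++ L') = encodeAll L ++ encodeAll L' := by
  simp [encodeAll]

@[simp] theorem encodeAll_singleton (ws : List ℕ) : encodeAll [ws] = ws.length :: ws := by
  simp [encodeAll]

theorem length_encodeAll (L : List (List ℕ)) :
    (encodeAll L).length = (L.map fun ws => ws.length + 1).sum := by
  simp [encodeAll, List.length_flatMap]

theorem encodeAll_split {L : List (List ℕ)} {j : ℕ} (hj : j < L.length) :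
    encodeAll L = encodeAll (L.take j) ++ (L[j].length :: L[j]) ++ encodeAll (L.drop (j + 1)) := by
  conv_lhs => rw [← List.take_append_drop j L, List.drop_eq_getElem_cons hj]
  rw [encodeAll_append, ← List.singleton_append, encodeAll_append]
  simp

theorem encodeAll_take_succ {L : List (List ℕ)} {j : ℕ} (hj : j < L.length) :
    encodeAll (L.take (j + 1)) = encodeAll (L.take j) ++ (L[j].length :: L[j]) := by
  rw [List.take_succ_eq_append_getElem hj, encodeAll_append, encodeAll_singleton]

theorem sum_length_getD (L : List (List ℕ)) (c : ℕ) :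
    ∑ j ∈ Finset.range L.length, c * ((L.getD j []).length + 1) = c * (encodeAll L).length := by
  rw [← Finset.mul_sum]
  congr 1
  have : ∀ J ≤ L.length, ∑ j ∈ Finset.range J, ((L.getD j []).length + 1) =
      (encodeAll (L.take J)).length := by
    intro J hJ
    induction J with
    | zero => simp [encodeAll]
    | succ J ih =>
      rw [Finset.sum_range_succ, ih (by omega), encodeAll_take_succ (by omega)]
      simp [List.getD_eq_getElem?_getD, show J < L.length by omega]
  simpa using this L.length le_rfl

/-- A path stored at the address `e.1` with the vertex sequence `e.2`. -/
structure Entry (ST : ℕ → ℕ) (W : ℕ → ℝ) (wt : List ℕ → ℝ) (bound : ℕ) (e : ℕ × List ℕ) :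
    Prop where
  seg : Seg ST e.1 (e.2.length :: e.2)
  weight : W e.1 = wt e.2
  lt : e.1 + e.2.length < bound

theorem Entry.congr {ST ST' : ℕ → ℕ} {W W' : ℕ → ℝ} {wt : List ℕ → ℝ} {bound bound' : ℕ}
    {e : ℕ × List ℕ} (h : Entry ST W wt bound e) (hST : ∀ a < bound, ST' a = ST a)
    (hW : ∀ a < bound, W' a = W a) (hb : bound ≤ bound') : Entry ST' W' wt bound' e where
  seg := h.seg.congr fun i _ hi => hST i (by have := h.lt; simp at hi; omega)
  weight := (hW _ (by have := h.lt; omega)).trans h.weight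
  lt := h.lt.trans_le hb

/-- The list `es` of stored paths is kept in the array `ptrs`. -/
structure Stored (ptrs ST : ℕ → ℕ) (W : ℕ → ℝ) (wt : List ℕ → ℝ) (bound : ℕ)
    (es : List (ℕ × List ℕ)) : Prop where
  ptrs : Seg ptrs 0 (es.map Prod.fst)
  entry : ∀ e ∈ es, Entry ST W wt bound e

/-- The second and the last but one word of `ws` differ in the `i`-th bit and agree in all lower
bits, where `p = 2 ^ i` and the bit of the second one is `0`. -/
def isLowest (p : ℕ) (ws : List ℕ) : Bool :=
  ws.getD (ws.length - 2) 0 % (p + p) = ws.getD 1 0 % (p + p) + p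

/-- The inner vertices next to the ends of `ws` are not the new copy of `x`. -/
structure Valid (n : ℕ) (ws : List ℕ) : Prop where
  two_le : 2 ≤ ws.length
  le : ∀ w ∈ ws, w ≤ n
  fst_lt : ws.getD 1 0 < n
  lst_lt : ws.getD (ws.length - 2) 0 < n

/-- Each path costs a constant times its length, and the paths lie one after the other in the
output, so the total is linear in the length of the output. The weight of a path is stored under the
address of the path, hence old weights, which sit below `base`, survive. -/
theorem parse_runs {O : Algo} {σ : Store} {n x p base : ℕ} {W : ℕ → ℝ} {L : List (List ℕ)}
    (hT : Tables n x p W σ) (hx : x < n) (hb : σ.var 6 = base)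
    (hlen : σ.var 12 = (encodeSeqs L).length) (hseg : Seg (σ.arr 4) base (encodeSeqs L))
    (hL : ∀ ws ∈ L, Valid n ws) :
    Runs O parse σ fun σ' t => ∃ fs : List (ℕ × List ℕ),
      fs.map Prod.snd = L.filter (isLowest p) ∧ σ'.var 8 = fs.length ∧
      Stored (σ'.arr 5) (σ'.arr 4) (σ'.wts 2) (pathWt (matWt n x W))
        (base + (encodeSeqs L).length) fs ∧
      (∀ i < base, σ'.wts 2 i = σ.wts 2 i) ∧ σ'.var 6 = base + (encodeSeqs L).length ∧
      t ≤ 10 * (encodeSeqs L).length + 5 := by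
  obtain ⟨hcnt, hseg⟩ := hseg
  replace hseg : Seg (σ.arr 4) (base + 1) (encodeAll L) := hseg
  refine runs_seq (runs_setVar (runs_seq (runs_setVar (runs_seq ((Runs.for L.length
    (fun j => 3 * (L.getD j []).length + 8)
    (fun j σ' => σ'.var 13 = base + 1 + (encodeAll (L.take j)).length ∧
      ∃ fs : List (ℕ × List ℕ), fs.map Prod.snd = (L.take j).filter (isLowest p) ∧
        σ'.var 8 = fs.length ∧
        Stored (σ'.arr 5) (σ.arr 4) (σ'.wts 2) (pathWt (matWt n x W))
          (base + 1 + (encodeAll (L.take j)).length) fs ∧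
        ∀ i < base, σ'.wts 2 i = σ.wts 2 i)
    (by decide) ?_ ?_ ?_).mono ?_)))))
  · intro σ' hF
    have h4 : σ'.arr 4 = σ.arr 4 := (hF.arr 4 (by decide)).trans (by simp)
    have h6 : σ'.var 6 = base := (hF.var 6 (by decide)).trans (by simp [hb])
    simp [NExpr.eval, h4, h6, hcnt]
  · refine ⟨by simp [NExpr.eval, hb, encodeAll], [], by simp, by simp [NExpr.eval], ⟨?_, ?_⟩, ?_⟩ <;>
      simp
  · rintro j hj σ₁ hF hv ⟨h13, fs, hfs, h8, hst, hold⟩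
    have e4 : σ₁.arr 4 = σ.arr 4 := (hF.arr 4 (by decide)).trans (by simp)
    have hT₁ : Tables n x p W σ₁ :=
      ⟨(hF.arr 8 (by decide)) ▸ hT.mul, (hF.arr 9 (by decide)) ▸ hT.cl,
        (hF.arr 10 (by decide)) ▸ hT.res, (hF.var 5 (by decide)).trans (by simp [hT.pow]),
        (hF.wts 1 (by decide)).trans (by simp [hT.mat])⟩
    clear hF hT
    set ptr := base + 1 + (encodeAll (L.take j)).length with hptr
    have hval := hL _ (List.getElem_mem hj)
    set ws := L[j] with hws
    have hD : L.getD j [] = ws := by simp [List.getD_eq_getElem?_getD, hj, hws]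
    have hseg' : Seg (σ.arr 4) ptr (ws.length :: ws) := by
      rw [encodeAll_split hj, seg_append, seg_append] at hseg
      exact hseg.1.2
    have hsucc : base + 1 + (encodeAll (L.take (j + 1))).length = ptr + ws.length + 1 := by
      rw [encodeAll_take_succ hj]; simp [hptr, ← hws]; omega
    refine runs_seq (runs_setVar (runs_seq ((weigh_runs (ptr := ptr) (ws := ws)
      (hT₁.of_frame (c := .setVar 14 (.arr 4 (.var 13))) (Exec.setVar (O := O) _ _ _).frame
      (by decide) (by decide) (by decide) (by decide) (by decide)) hx (by simp [h13])
      (by simp [NExpr.eval, h13, e4, hseg'.1]) (by simpa [e4] using hseg'.2)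
      hval.le).mono_frame ?_)))
    rintro σ₂ t₂ hF₂ ⟨hw2, ht₂⟩
    have e4' : σ₂.arr 4 = σ.arr 4 := (hF₂.arr 4 (by decide)).trans (by simp [e4])
    have e5' : σ₂.arr 5 = σ₁.arr 5 := (hF₂.arr 5 (by decide)).trans (by simp)
    have e8' : σ₂.var 8 = fs.length := (hF₂.var 8 (by decide)).trans (by simp [h8])
    have e13' : σ₂.var 13 = ptr := (hF₂.var 13 (by decide)).trans (by simp [h13])
    have e14' : σ₂.var 14 = ws.length := (hF₂.var 14 (by decide)).trans
      (by simp [NExpr.eval, h13, e4, hseg'.1])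
    have e10' : σ₂.arr 10 = σ₁.arr 10 := (hF₂.arr 10 (by decide)).trans (by simp)
    have ep' : σ₂.var 5 = p := (hF₂.var 5 (by decide)).trans (by simp [hT₁.pow])
    simp only [Store.setVar_wts] at hw2
    clear hF₂
    -- The words begin at `ptr + 1`, after the length: the second one is at `ptr + 2`, the last but
    -- one at `ptr + ws.length - 1`.
    have ga := hseg'.2.get (j := 1) (by have := hval.two_le; omega)
    have gb := hseg'.2.get (j := ws.length - 2) (by have := hval.two_le; omega)
    rw [show ptr + 1 + 1 = ptr + 2 by omega] at ga
    rw [show ptr + 1 + (ws.length - 2) = ptr + ws.length - 1 by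
      have := hval.two_le; omega] at gb
    have hent : ∀ e ∈ fs, Entry (σ.arr 4) (Function.update (σ₁.wts 2) ptr
        (pathWt (matWt n x W) ws)) (pathWt (matWt n x W)) (ptr + ws.length + 1) e := fun e he =>
      (hst.entry e he).congr (fun _ _ => rfl)
        (fun a ha => Function.update_of_ne (by omega) _ _) (by omega)
    have hnew : Entry (σ.arr 4) (Function.update (σ₁.wts 2) ptr (pathWt (matWt n x W) ws))
        (pathWt (matWt n x W)) (ptr + ws.length + 1) (ptr, ws) :=
      ⟨hseg', by simp, by simp⟩
    have hold' : ∀ i < base, Function.update (σ₁.wts 2) ptr (pathWt (matWt n x W) ws) i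
        = σ.wts 2 i := fun i hi => by rw [Function.update_of_ne (by omega), hold i hi]
    -- The residue table covers labels below `n` only; validity ensures that neither inspected word
    -- is the new copy `n` of `x`.
    have htest : (Test.eq (.arr 10 (.arr 4 (.sub (.var 13 ⊹ .var 14) (.const 1))))
        (.arr 10 (.arr 4 (.var 13 ⊹ .const 2)) ⊹ .var 5)).holds σ₂ ↔ isLowest p ws = true := by
      simp only [Test.holds, NExpr.eval, e13', e14', e4', ga, gb, e10', ep',
        hT₁.res _ hval.fst_lt, hT₁.res _ hval.lst_lt, ← le_antisymm_iff]
      simp [isLowest]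
    rw [hD, hsucc, List.take_succ_eq_append_getElem hj, List.filter_append, ← hws]
    refine runs_seq (runs_ite (fun h => runs_seq (runs_setArr (runs_setVar (runs_setVar ?_))))
      fun h => runs_skip (runs_setVar ?_))
    · rw [htest] at h
      refine ⟨⟨by simp [NExpr.eval, e13', e14'], fs ++ [(ptr, ws)], by simp [hfs, h],
        by simp [NExpr.eval, e8'], ⟨?_, ?_⟩, ?_⟩, by omega⟩
      · have := hst.ptrs.snoc ptr
        simpa [NExpr.eval, e8', e13', e5'] using this
      · intro e he
        rw [List.mem_append, List.mem_singleton] at he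
        simp only [Store.setVar_wts, Store.setArr_wts, hw2]
        rcases he with he | rfl
        · exact hent e he
        · exact hnew
      · simpa [hw2] using hold'
    · rw [htest] at h
      refine ⟨⟨by simp [NExpr.eval, e13', e14'], fs, by simp [hfs, h],
        by simp [e8'], ⟨?_, ?_⟩, ?_⟩, by omega⟩
      · simpa [e5'] using hst.ptrs
      · intro e he
        simp only [Store.setVar_wts, hw2]
        exact hent e he
      · simpa [hw2] using hold'
  · rintro σ₁ t ⟨hF, ⟨h13, fs, hfs, h8, hst, hold⟩, ht⟩
    have e4 : σ₁.arr 4 = σ.arr 4 := (hF.arr 4 (by decide)).trans (by simp)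
    have e6 : σ₁.var 6 = base := (hF.var 6 (by decide)).trans (by simp [hb])
    have e12 : σ₁.var 12 = (encodeSeqs L).length := (hF.var 12 (by decide)).trans (by simp [hlen])
    have hl : base + (encodeSeqs L).length = base + 1 + (encodeAll (L.take L.length)).length := by
      rw [encodeSeqs_eq]; simp; omega
    refine runs_setVar ⟨fs, by simpa using hfs, by simp [h8], ⟨by simpa using hst.ptrs, ?_⟩,
      by simpa using hold, by simp [NExpr.eval, e6, e12], ?_⟩
    · rw [hl]
      simpa [e4] using hst.entry
    · have h1 : ∑ j ∈ Finset.range L.length, (3 * (L.getD j []).length + 8 + 2) ≤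
          10 * (encodeAll L).length := by
        rw [← sum_length_getD]
        exact Finset.sum_le_sum fun j _ => by omega
      rw [encodeSeqs_eq, List.length_cons]
      omega

open Classical in
/-- Merge two lists of stored paths by weight. -/
noncomputable def mergeStored (wt : List ℕ → ℝ) (es fs : List (ℕ × List ℕ)) :
    List (ℕ × List ℕ) :=
  es.merge fs fun e f => decide (wt e.2 ≤ wt f.2)

theorem length_mergeStored (wt : List ℕ → ℝ) (es fs : List (ℕ × List ℕ)) :
    (mergeStored wt es fs).length = es.length + fs.length := by
  simp [mergeStored]

theorem mem_mergeStored {wt : List ℕ → ℝ} {es fs : List (ℕ × List ℕ)} {e : ℕ × List ℕ} :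
    e ∈ mergeStored wt es fs ↔ e ∈ es ∨ e ∈ fs :=
  List.mem_merge

/-- The invariant: the entries `ns` written so far, followed by the merge of the two remaining
suffixes, are the complete merge. The two cursors add up to the loop counter. -/
theorem mergeLists_runs {O : Algo} {σ : Store} {wt : List ℕ → ℝ} {bound : ℕ}
    {es fs : List (ℕ × List ℕ)}
    (h7 : σ.var 7 = es.length) (h8 : σ.var 8 = fs.length)
    (hes : Stored (σ.arr 6) (σ.arr 4) (σ.wts 2) wt bound es)
    (hfs : Stored (σ.arr 5) (σ.arr 4) (σ.wts 2) wt bound fs) :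
    Runs O mergeLists σ fun σ' t => Seg (σ'.arr 7) 0 ((mergeStored wt es fs).map Prod.fst) ∧
      t ≤ 5 * (es.length + fs.length) + 4 := by
  refine runs_seq (runs_setVar (runs_seq (runs_setVar ((Runs.for_const (es.length + fs.length) 3
    (fun j σ' => ∃ a f, ∃ ns : List (ℕ × List ℕ), σ'.var 15 = a ∧ σ'.var 16 = f ∧ a + f = j ∧
      a ≤ es.length ∧ f ≤ fs.length ∧ ns.length = j ∧
      ns ++ mergeStored wt (es.drop a) (fs.drop f) = mergeStored wt es fs ∧
      Seg (σ'.arr 7) 0 (ns.map Prod.fst))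
    (by decide) ?_ ?_ ?_).mono ?_))))
  · intro σ' hF
    have e7 : σ'.var 7 = es.length := (hF.var 7 (by decide)).trans (by simp [h7])
    have e8 : σ'.var 8 = fs.length := (hF.var 8 (by decide)).trans (by simp [h8])
    simp [NExpr.eval, e7, e8]
  · exact ⟨0, 0, [], by simp [NExpr.eval]⟩
  · rintro j hj σ' hF hv ⟨a, f, ns, h15, h16, haf, ha, hf, hns, hmerge, hseg⟩
    have e7 : σ'.var 7 = es.length := (hF.var 7 (by decide)).trans (by simp [h7])
    have e8 : σ'.var 8 = fs.length := (hF.var 8 (by decide)).trans (by simp [h8])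
    have e5 : σ'.arr 5 = σ.arr 5 := (hF.arr 5 (by decide)).trans (by simp)
    have e6 : σ'.arr 6 = σ.arr 6 := (hF.arr 6 (by decide)).trans (by simp)
    have w2 : σ'.wts 2 = σ.wts 2 := (hF.wts 2 (by decide)).trans (by simp)
    clear hF
    have pe : ∀ h : a < es.length, σ.arr 6 a = es[a].1 := fun h => by
      have := hes.ptrs.get (j := a) (by simpa using h)
      simpa [h] using this
    have pf : ∀ h : f < fs.length, σ.arr 5 f = fs[f].1 := fun h => by
      have := hfs.ptrs.get (j := f) (by simpa using h)
      simpa [h] using this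
    have we : ∀ h : a < es.length, σ.wts 2 es[a].1 = wt es[a].2 := fun h =>
      (hes.entry _ (List.getElem_mem h)).weight
    have wf : ∀ h : f < fs.length, σ.wts 2 fs[f].1 = wt fs[f].2 := fun h =>
      (hfs.entry _ (List.getElem_mem h)).weight
    have key : ∀ e : ℕ × List ℕ, Seg (Function.update (σ'.arr 7) j e.1) 0
        ((ns ++ [e]).map Prod.fst) := fun e => by
      have := hseg.snoc e.1
      simpa [hns] using this
    refine runs_ite (fun h => runs_seq (runs_setArr (runs_setVar ?_)))
      fun h => runs_seq (runs_setArr (runs_setVar ?_))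
    · simp only [Test.holds, NExpr.eval, RExpr.eval, h15, h16, e7, e8, e5, e6, w2, not_le,
        not_and] at h
      obtain ⟨h1, h2⟩ := h
      refine ⟨⟨a + 1, f, ns ++ [es[a]], by simp [NExpr.eval, h15], by simp [h16], by omega,
        by omega, hf, by simp [hns], ?_, ?_⟩, by omega⟩
      · rw [← hmerge, List.append_assoc, List.drop_eq_getElem_cons h1]
        congr 1
        rcases Nat.lt_or_ge f fs.length with hlt | hge
        · have h2 := h2 hlt
          rw [pe h1, pf hlt, we h1, wf hlt] at h2
          rw [List.drop_eq_getElem_cons hlt, mergeStored, mergeStored, List.cons_merge_cons,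
            if_pos (by simpa using h2)]
          rfl
        · simp [List.drop_eq_nil_of_le hge, mergeStored]
      · simpa [NExpr.eval, hv, e6, h15, pe h1] using key es[a]
    · simp only [Test.holds, NExpr.eval, RExpr.eval, h15, h16, e7, e8, e5, e6, w2, not_le,
        not_and] at h
      -- If the new list were exhausted, the old one would not be, because `j` is below the total
      -- length, and the test would have succeeded.
      have hlt : f < fs.length := by
        by_contra hge
        exact h (by omega) (fun h' => absurd h' hge)
      refine ⟨⟨a, f + 1, ns ++ [fs[f]], by simp [h15], by simp [NExpr.eval, h16], by omega,
        by omega, by omega, by simp [hns], ?_, ?_⟩, by omega⟩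
      · rw [← hmerge, List.append_assoc, List.drop_eq_getElem_cons hlt]
        congr 1
        rcases Nat.lt_or_ge a es.length with h1 | hge
        · have h2 : ¬ wt es[a].2 ≤ wt fs[f].2 := fun hle => h h1 fun _ => by
            rw [pe h1, pf hlt, we h1, wf hlt]
            exact not_lt.2 hle
          rw [List.drop_eq_getElem_cons h1, mergeStored, mergeStored, List.cons_merge_cons,
            if_neg (by simpa using h2)]
          rfl
        · simp [List.drop_eq_nil_of_le hge, mergeStored]
      · simpa [NExpr.eval, hv, e5, h16, pf hlt] using key fs[f]
  · rintro σ' t ⟨-, ⟨a, f, ns, -, -, haf, ha, hf, -, hmerge, hseg⟩, ht⟩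
    refine ⟨?_, by omega⟩
    rw [← hmerge, List.drop_eq_nil_of_le (by omega), List.drop_eq_nil_of_le (by omega)]
    simpa [mergeStored] using hseg

theorem truncate_runs {O : Algo} {σ : Store} {k : ℕ} {ns : List (ℕ × List ℕ)}
    (h3 : σ.var 3 = k) (h78 : σ.var 7 + σ.var 8 = ns.length)
    (hns : Seg (σ.arr 7) 0 (ns.map Prod.fst)) :
    Runs O truncate σ fun σ' t => σ'.var 7 = (ns.take k).length ∧
      Seg (σ'.arr 6) 0 ((ns.take k).map Prod.fst) ∧ t ≤ 3 * ns.length + 4 := by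
  have r1 : Runs O (.ite (.le (.var 7 ⊹ .var 8) (.var 3)) (.setVar 7 (.var 7 ⊹ .var 8))
      (.setVar 7 (.var 3))) σ fun σ' t => σ'.var 7 = (ns.take k).length ∧ t = 2 := by
    refine runs_ite (fun h => runs_setVar ?_) fun h => runs_setVar ?_ <;>
    · simp only [Test.holds, NExpr.eval, h78, h3] at h
      simp [NExpr.eval, h78, h3]
      omega
  refine runs_seq (r1.mono_frame ?_)
  rintro σ₁ _ hF₁ ⟨h7, rfl⟩
  have e7 : σ₁.arr 7 = σ.arr 7 := hF₁.arr 7 (by decide)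
  refine (Runs.for_const (ns.take k).length 1
    (fun j σ' => ∀ a < j, σ'.arr 6 a = σ.arr 7 a) (by decide) ?_ ?_ ?_).mono ?_
  · intro σ' hF
    exact (hF.var 7 (by decide)).trans h7
  · simp
  · intro j hj σ' hF hv hI
    have e7' : σ'.arr 7 = σ.arr 7 := (hF.arr 7 (by decide)).trans e7
    refine runs_setArr ⟨fun a ha => ?_, le_rfl⟩
    by_cases haj : a = j
    · simp [NExpr.eval, hv, e7', haj]
    · simpa [NExpr.eval, hv, haj] using hI a (by omega)
  · rintro σ' t ⟨hF, hI, ht⟩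
    have hle : (ns.take k).length ≤ ns.length := by simp
    refine ⟨(hF.var 7 (by decide)).trans h7, ?_, by omega⟩
    have hsplit := hns
    rw [← List.take_append_drop k ns, List.map_append, seg_append] at hsplit
    exact hsplit.1.congr fun i _ hi => hI i (by simpa using hi)

theorem writePath_runs {O : Algo} {σ : Store} {n x ptr : ℕ} {l ws : List ℕ}
    (hcl : ∀ u ≤ n, σ.arr 9 u = coll n x u) (hptr : σ.arr 6 (σ.var 9) = ptr)
    (hs : Seg (σ.arr 4) ptr (ws.length :: ws)) (hws : ∀ w ∈ ws, w ≤ n)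
    (h11 : σ.var 11 = l.length) (hl : Seg (σ.arr 1) 0 l) :
    Runs O writePath σ fun σ' t =>
      Seg (σ'.arr 1) 0 (l ++ (ws.length :: ws.map (coll n x))) ∧
      σ'.var 11 = (l ++ (ws.length :: ws.map (coll n x))).length ∧ t ≤ 3 * ws.length + 7 := by
  obtain ⟨hs1, hs2⟩ := hs
  refine runs_seq (runs_setVar (runs_seq (runs_setVar (runs_seq (runs_setArr (runs_seq
    (runs_setVar (runs_seq ((Runs.for_const ws.length 1
      (fun j σ' => Seg (σ'.arr 1) 0 (l ++ (ws.length :: (ws.take j).map (coll n x))))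
      (by decide) ?_ ?_ ?_).mono ?_)))))))))
  · intro σ' hF
    exact (hF.var 14 (by decide)).trans (by simp [NExpr.eval, hptr, hs1])
  · have := hl.snoc ws.length
    simpa [NExpr.eval, h11, hptr, hs1] using this
  · intro j hj σ' hF hv hI
    have e4 : σ'.arr 4 = σ.arr 4 := (hF.arr 4 (by decide)).trans (by simp)
    have e9 : σ'.arr 9 = σ.arr 9 := (hF.arr 9 (by decide)).trans (by simp)
    have e11 : σ'.var 11 = l.length + 1 :=
      (hF.var 11 (by decide)).trans (by simp [NExpr.eval, h11])
    have e13 : σ'.var 13 = ptr := (hF.var 13 (by decide)).trans (by simp [NExpr.eval, hptr])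
    have g := hs2.get hj
    have := hI.snoc (coll n x (ws.getD j 0))
    refine runs_setArr ⟨?_, le_rfl⟩
    simp only [NExpr.eval, e11, hv, e4, e9, e13, g, hcl _ (getD_le hws j), Store.setVar_arr,
      Store.setArr_arr, if_true]
    rw [List.take_succ_eq_append_getElem hj]
    convert this using 1
    · congr 1
      simp [hj.le]; omega
    · simp [hj, -List.map_take, -List.take_append_getElem]
  · rintro σ' t ⟨hF, hI, ht⟩
    have e11 : σ'.var 11 = l.length + 1 :=
      (hF.var 11 (by decide)).trans (by simp [NExpr.eval, h11])
    have e14 : σ'.var 14 = ws.length :=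
      (hF.var 14 (by decide)).trans (by simp [NExpr.eval, hptr, hs1])
    refine runs_setVar ⟨by simpa using hI, ?_, by omega⟩
    simp [NExpr.eval, e11, e14]; omega

theorem writeOutput_runs {O : Algo} {σ : Store} {n x bound : ℕ} {wt : List ℕ → ℝ}
    {es : List (ℕ × List ℕ)} (hcl : ∀ u ≤ n, σ.arr 9 u = coll n x u) (h7 : σ.var 7 = es.length)
    (hes : Stored (σ.arr 6) (σ.arr 4) (σ.wts 2) wt bound es)
    (hle : ∀ e ∈ es, ∀ w ∈ e.2, w ≤ n) :
    Runs O writeOutput σ fun σ' t =>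
      σ'.output = encodeSeqs ((es.map Prod.snd).map fun ws => ws.map (coll n x)) ∧
      t ≤ 9 * (encodeSeqs (es.map Prod.snd)).length := by
  set L := (es.map Prod.snd).map fun ws => ws.map (coll n x) with hL
  have hLlen : L.length = es.length := by simp [hL]
  refine runs_seq (runs_setArr (runs_seq (runs_setVar (runs_seq ((Runs.for es.length
    (fun j => 3 * ((es.map Prod.snd).getD j []).length + 7)
    (fun j σ' => σ'.var 11 = (L.length :: encodeAll (L.take j)).length ∧
      Seg (σ'.arr 1) 0 (L.length :: encodeAll (L.take j)))
    (by decide) ?_ ?_ ?_).mono ?_)))))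
  · intro σ' hF
    have e7 : σ'.var 7 = es.length := (hF.var 7 (by decide)).trans (by simp [h7])
    simp [NExpr.eval, e7]
  · simp [NExpr.eval, encodeAll, h7, hLlen]
  · rintro j hj σ₁ hF hv ⟨h11, hseg⟩
    have e4 : σ₁.arr 4 = σ.arr 4 := (hF.arr 4 (by decide)).trans (by simp)
    have e6 : σ₁.arr 6 = σ.arr 6 := (hF.arr 6 (by decide)).trans (by simp)
    have e9 : σ₁.arr 9 = σ.arr 9 := (hF.arr 9 (by decide)).trans (by simp)
    clear hF
    have hent := hes.entry _ (List.getElem_mem hj)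
    have hptr : σ.arr 6 j = es[j].1 := by
      have := hes.ptrs.get (j := j) (by simpa using hj)
      simpa [hj] using this
    have hLj : L[j]'(by omega) = es[j].2.map (coll n x) := by simp [hL]
    rw [show (es.map Prod.snd).getD j [] = es[j].2 by simp [hj],
      encodeAll_take_succ (by omega : j < L.length), hLj]
    refine (writePath_runs (n := n) (x := x) (ptr := es[j].1) (ws := es[j].2) (by rwa [e9])
      (by rw [e6, hv, hptr]) (by rw [e4]; exact hent.seg) (hle _ (List.getElem_mem hj)) h11
      hseg).mono ?_
    rintro σ₂ t ⟨h1, h2, h3⟩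
    exact ⟨⟨by simpa using h2, by simpa using h1⟩, h3⟩
  · rintro σ₁ t ⟨hF, ⟨h11, hseg⟩, ht⟩
    rw [← hLlen, List.take_length] at h11 hseg
    refine runs_setVar ⟨?_, ?_⟩
    · rw [encodeSeqs_eq, Store.output]
      simpa [NExpr.eval, h11] using hseg.map_range
    · have h1 : ∑ j ∈ Finset.range es.length, (3 * ((es.map Prod.snd).getD j []).length + 7 + 2) ≤
          9 * (encodeAll (es.map Prod.snd)).length := by
        rw [← sum_length_getD, List.length_map]
        exact Finset.sum_le_sum fun j _ => by omega
      rw [encodeSeqs_eq, List.length_cons]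
      omega

/-- The instance written in the round with `p = 2 ^ i`. -/
def splitInput (n m k x p : ℕ) (e₁ e₂ : ℕ → ℕ) (w : ℕ → ℝ) : Input :=
  ([n + 1, m, k, x, n] ++ (List.range m).flatMap (fun j =>
    [redirectWord n x p (e₁ j) (e₂ j), redirectWord n x p (e₂ j) (e₁ j)]), (List.range m).map w)

open Classical in
/-- The `k` lightest paths after a round that reports the paths `L`, where `acc` are the `k` lightest
paths before that round. -/
noncomputable def update (wt : List ℕ → ℝ) (k p : ℕ) (acc L : List (List ℕ)) : List (List ℕ) :=
  (acc.merge (L.filter (isLowest p)) fun a b => decide (wt a ≤ wt b)).take k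

/-- The `k` lightest paths after `i` rounds. -/
noncomputable def lightest (wt : List ℕ → ℝ) (k : ℕ) (Ls : ℕ → List (List ℕ)) :
    ℕ → List (List ℕ)
  | 0 => []
  | i + 1 => update wt k (2 ^ i) (lightest wt k Ls i) (Ls i)

theorem mem_update {wt : List ℕ → ℝ} {k p : ℕ} {acc L : List (List ℕ)} {ws : List ℕ}
    (h : ws ∈ update wt k p acc L) : ws ∈ acc ∨ ws ∈ L := by
  rcases List.mem_merge.1 (List.mem_of_mem_take h) with h | h
  · exact .inl h
  · exact .inr (List.mem_of_mem_filter h)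

theorem length_encodeAll_le_of_sublist {L L' : List (List ℕ)} (h : L.Sublist L') :
    (encodeAll L).length ≤ (encodeAll L').length := by
  rw [length_encodeAll, length_encodeAll]
  exact (h.map _).sum_le_sum fun _ _ => Nat.zero_le _

theorem length_encodeAll_update (wt : List ℕ → ℝ) (k p : ℕ) (acc L : List (List ℕ)) :
    (encodeAll (update wt k p acc L)).length ≤ (encodeAll acc).length + (encodeAll L).length := by
  classical
  refine (length_encodeAll_le_of_sublist (List.take_sublist _ _)).trans ?_
  rw [length_encodeAll, ((List.merge_perm_append (xs := acc) (ys := L.filter (isLowest p))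
    (le := fun a b => decide (wt a ≤ wt b))).map _).sum_eq, ← length_encodeAll, encodeAll_append,
    List.length_append]
  exact Nat.add_le_add_left (length_encodeAll_le_of_sublist List.filter_sublist) _

theorem length_le_length_encodeAll (L : List (List ℕ)) : L.length ≤ (encodeAll L).length := by
  induction L with
  | nil => simp
  | cons ws L ih =>
    rw [← List.singleton_append, encodeAll_append]
    simp; omega

theorem length_lightest_le (wt : List ℕ → ℝ) (k : ℕ) (Ls : ℕ → List (List ℕ)) (i : ℕ) :
    (lightest wt k Ls i).length ≤ k := by
  cases i with
  | zero => simp [lightest]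
  | succ i => simp [lightest, update]

/-- Every surviving path was reported in some round, and filtering, merging and truncating never
duplicate one. The resulting bound on the size of the list does not involve `k`. -/
theorem length_encodeAll_lightest {wt : List ℕ → ℝ} {k T : ℕ} {Ls : ℕ → List (List ℕ)} {N : ℕ}
    (h : ∀ i < N, (encodeSeqs (Ls i)).length ≤ T) :
    (encodeAll (lightest wt k Ls N)).length ≤ N * T := by
  induction N with
  | zero => simp [lightest, encodeAll]
  | succ N ih =>
    have h1 := ih fun i hi => h i (by omega)
    have h2 := h N (by omega)
    have h3 := length_encodeAll_update wt k (2 ^ N) (lightest wt k Ls N) (Ls N)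
    rw [encodeSeqs_eq, List.length_cons] at h2
    rw [lightest, add_mul]
    omega

theorem valid_lightest {wt : List ℕ → ℝ} {n k : ℕ} {Ls : ℕ → List (List ℕ)} {N : ℕ}
    (h : ∀ i < N, ∀ ws ∈ Ls i, Valid n ws) : ∀ ws ∈ lightest wt k Ls N, Valid n ws := by
  induction N with
  | zero => simp [lightest]
  | succ N ih =>
    intro ws hws
    rcases mem_update hws with h' | h'
    · exact ih (fun i hi => h i (by omega)) ws h'
    · exact h N (by omega) ws h'

/-- The state of the machine between two rounds. -/
structure State (n m k x : ℕ) (e₁ e₂ : ℕ → ℕ) (w W : ℕ → ℝ) (p : ℕ) (acc : List (List ℕ))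
    (σ : Store) : Prop where
  n_eq : σ.var 1 = n
  m_eq : σ.var 2 = m
  k_eq : σ.var 3 = k
  x_eq : σ.var 4 = x
  p_eq : σ.var 5 = p
  fst_eq : ∀ j < m, σ.arr 0 (4 + (j + j)) = e₁ j
  snd_eq : ∀ j < m, σ.arr 0 (5 + (j + j)) = e₂ j
  wts_eq : ∀ j < m, σ.wts 0 j = w j
  mul_eq : ∀ u < n, σ.arr 8 u = u * n
  cl_eq : ∀ u ≤ n, σ.arr 9 u = coll n x u
  mat_eq : σ.wts 1 = W
  stored : ∃ es : List (ℕ × List ℕ), es.map Prod.snd = acc ∧ σ.var 7 = es.length ∧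
    Stored (σ.arr 6) (σ.arr 4) (σ.wts 2) (pathWt (matWt n x W)) (σ.var 6) es

/-! ### The rounds, the loop and the setup -/

section

variable {O : Algo} {n m k x p : ℕ} {e₁ e₂ : ℕ → ℕ} {w W : ℕ → ℝ} {acc : List (List ℕ)}
  {σ : Store}

theorem State.of_frame (h : State n m k x e₁ e₂ w W p acc σ) {σ' : Store} {c : Prog}
    (hF : Frame c σ σ') (hv : ∀ y ∈ [1, 2, 3, 4, 5, 6, 7], y ∉ c.vars)
    (ha : ∀ a ∈ [0, 4, 6, 8, 9], a ∉ c.arrs) (hr : ∀ b ∈ [0, 1, 2], b ∉ c.reals) :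
    State n m k x e₁ e₂ w W p acc σ' where
  n_eq := (hF.var 1 (hv _ (by simp))).trans h.n_eq
  m_eq := (hF.var 2 (hv _ (by simp))).trans h.m_eq
  k_eq := (hF.var 3 (hv _ (by simp))).trans h.k_eq
  x_eq := (hF.var 4 (hv _ (by simp))).trans h.x_eq
  p_eq := (hF.var 5 (hv _ (by simp))).trans h.p_eq
  fst_eq := hF.arr 0 (ha _ (by simp)) ▸ h.fst_eq
  snd_eq := hF.arr 0 (ha _ (by simp)) ▸ h.snd_eq
  wts_eq := hF.wts 0 (hr _ (by simp)) ▸ h.wts_eq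
  mul_eq := hF.arr 8 (ha _ (by simp)) ▸ h.mul_eq
  cl_eq := hF.arr 9 (ha _ (by simp)) ▸ h.cl_eq
  mat_eq := hF.wts 1 (hr _ (by simp)) ▸ h.mat_eq
  stored := by
    rw [hF.arr 4 (ha _ (by simp)), hF.arr 6 (ha _ (by simp)), hF.wts 2 (hr _ (by simp)),
      hF.var 6 (hv _ (by simp)), hF.var 7 (hv _ (by simp))]
    exact h.stored

theorem beforeCall_runs (h : State n m k x e₁ e₂ w W p acc σ) (hp : 0 < p)
    (he₁ : ∀ j < m, e₁ j < n) (he₂ : ∀ j < m, e₂ j < n) :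
    Runs O beforeCall σ fun σ' t => State n m k x e₁ e₂ w W p acc σ' ∧
      (∀ y < n, σ'.arr 10 y = y % (p + p)) ∧
      Seg (σ'.arr 2) 0 (splitInput n m k x p e₁ e₂ w).1 ∧ t ≤ 6 * n + 6 * m + 10 := by
  refine runs_seq ((makeResidues_runs h.n_eq h.p_eq hp).mono_frame ?_)
  rintro σ₁ t₁ hF₁ ⟨hres, ht₁⟩
  have h₁ := h.of_frame hF₁ (by decide) (by decide) (by decide)
  refine (makeSplit_runs h₁.n_eq h₁.m_eq h₁.k_eq h₁.x_eq h₁.p_eq hres h₁.fst_eq h₁.snd_eq he₁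
    he₂).mono_frame ?_
  rintro σ₂ t₂ hF₂ ⟨hseg, ht₂⟩
  exact ⟨h₁.of_frame hF₂ (by decide) (by decide) (by decide),
    hF₂.arr 10 (by decide) ▸ hres, hseg, by omega⟩

theorem map_snd_mergeStored (wt : List ℕ → ℝ) (es fs : List (ℕ × List ℕ)) :
    open Classical in (mergeStored wt es fs).map Prod.snd =
      (es.map Prod.snd).merge (fs.map Prod.snd) fun a b => decide (wt a ≤ wt b) :=
  List.map_merge (by simp)

/-- Old paths are represented by their addresses, so they are not copied again: apart from the new
output, the cost depends only on their number. -/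
theorem afterCall_runs {L : List (List ℕ)} (h : State n m k x e₁ e₂ w W p acc σ) (hx : x < n)
    (hres : ∀ y < n, σ.arr 10 y = y % (p + p)) (hlen : σ.var 12 = (encodeSeqs L).length)
    (hout : Seg (σ.arr 3) 0 (encodeSeqs L)) (hL : ∀ ws ∈ L, Valid n ws) :
    Runs O afterCall σ fun σ' t => State n m k x e₁ e₂ w W (p + p)
      (update (pathWt (matWt n x W)) k p acc L) σ' ∧
      t ≤ 8 * acc.length + 21 * (encodeSeqs L).length + 16 := by
  obtain ⟨es, hes, h7, hst⟩ := h.stored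
  refine runs_seq ((copyResult_runs rfl hlen hout).mono_frame ?_)
  rintro σ₁ t₁ hF₁ ⟨hseg₁, hold₁, ht₁⟩
  have b₁ : σ₁.var 6 = σ.var 6 := hF₁.var 6 (by decide)
  have hT₁ : Tables n x p W σ₁ :=
    ⟨(hF₁.arr 8 (by decide)) ▸ h.mul_eq, (hF₁.arr 9 (by decide)) ▸ h.cl_eq,
      (hF₁.arr 10 (by decide)) ▸ hres, (hF₁.var 5 (by decide)).trans h.p_eq,
      (hF₁.wts 1 (by decide)).trans h.mat_eq⟩
  refine runs_seq ((parse_runs hT₁ hx b₁ ((hF₁.var 12 (by decide)).trans hlen) hseg₁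
    hL).mono_frame ?_)
  rintro σ₂ t₂ hF₂ ⟨fs, hfs, h8, hst₂, hold₂, b₂, ht₂⟩
  have a4 : σ₂.arr 4 = σ₁.arr 4 := hF₂.arr 4 (by decide)
  have a6 : σ₂.arr 6 = σ.arr 6 := (hF₂.arr 6 (by decide)).trans (hF₁.arr 6 (by decide))
  have v7 : σ₂.var 7 = es.length :=
    ((hF₂.var 7 (by decide)).trans (hF₁.var 7 (by decide))).trans h7
  -- Old entries lie below the former end of the storage, where neither the copying nor the weighing
  -- has written.
  have hst' : Stored (σ₂.arr 6) (σ₂.arr 4) (σ₂.wts 2) (pathWt (matWt n x W))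
      (σ.var 6 + (encodeSeqs L).length) es := by
    refine ⟨a6 ▸ hst.ptrs, fun e he => (hst.entry e he).congr ?_ ?_ (by omega)⟩
    · intro a ha; rw [a4, hold₁ a ha]
    · intro a ha; rw [hold₂ a ha, hF₁.wts 2 (by decide)]
  refine runs_seq ((mergeLists_runs v7 h8 hst' hst₂).mono_frame ?_)
  rintro σ₃ t₃ hF₃ ⟨hseg₃, ht₃⟩
  have v3 : σ₃.var 3 = k := (((hF₃.var 3 (by decide)).trans (hF₂.var 3 (by decide))).trans
    (hF₁.var 3 (by decide))).trans h.k_eq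
  refine runs_seq ((truncate_runs v3 (by
    rw [hF₃.var 7 (by decide), hF₃.var 8 (by decide), v7, h8, length_mergeStored])
    hseg₃).mono_frame ?_)
  rintro σ₄ t₄ hF₄ ⟨h7', hseg₄, ht₄⟩
  refine runs_setVar ⟨?_, ?_⟩
  · have fv : ∀ y ∈ [1, 2, 3, 4, 5], σ₄.var y = σ.var y := fun y hy => by
      rw [hF₄.var y (by revert y; decide), hF₃.var y (by revert y; decide),
        hF₂.var y (by revert y; decide), hF₁.var y (by revert y; decide)]
    have fa : ∀ a ∈ [0, 8, 9], σ₄.arr a = σ.arr a := fun a ha => by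
      rw [hF₄.arr a (by revert a; decide), hF₃.arr a (by revert a; decide),
        hF₂.arr a (by revert a; decide), hF₁.arr a (by revert a; decide)]
    have fw : ∀ b ∈ [0, 1], σ₄.wts b = σ.wts b := fun b hb => by
      rw [hF₄.wts b (by revert b; decide), hF₃.wts b (by revert b; decide),
        hF₂.wts b (by revert b; decide), hF₁.wts b (by revert b; decide)]
    refine ⟨?_, ?_, ?_, ?_, ?_, ?_, ?_, ?_, ?_, ?_, ?_,
      (mergeStored (pathWt (matWt n x W)) es fs).take k, ?_, ?_, ?_, ?_⟩
    · simpa [h.n_eq] using fv 1 (by simp)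
    · simpa [h.m_eq] using fv 2 (by simp)
    · simpa [h.k_eq] using fv 3 (by simp)
    · simpa [h.x_eq] using fv 4 (by simp)
    · have := fv 5 (by simp)
      simp [NExpr.eval, this, h.p_eq]
    · simpa [fa 0 (by simp)] using h.fst_eq
    · simpa [fa 0 (by simp)] using h.snd_eq
    · simpa [fw 0 (by simp)] using h.wts_eq
    · simpa [fa 8 (by simp)] using h.mul_eq
    · simpa [fa 9 (by simp)] using h.cl_eq
    · simpa [fw 1 (by simp)] using h.mat_eq
    · rw [List.map_take, map_snd_mergeStored, hes, hfs, update]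
    · simpa using h7'
    · exact hseg₄
    · intro e he
      have he' := mem_mergeStored.1 (List.mem_of_mem_take he)
      have c4 : σ₄.arr 4 = σ₂.arr 4 := (hF₄.arr 4 (by decide)).trans (hF₃.arr 4 (by decide))
      have c2 : σ₄.wts 2 = σ₂.wts 2 := (hF₄.wts 2 (by decide)).trans (hF₃.wts 2 (by decide))
      have c6 : σ₄.var 6 = σ.var 6 + (encodeSeqs L).length :=
        ((hF₄.var 6 (by decide)).trans (hF₃.var 6 (by decide))).trans b₂
      simp only [Store.setVar_arr, Store.setVar_wts, Store.setVar_var, c4, c2, c6]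
      exact he'.elim (hst'.entry e) (hst₂.entry e)
  · have h1 : es.length = acc.length := by rw [← hes, List.length_map]
    have h2 : fs.length ≤ L.length := by
      rw [← List.length_map (f := Prod.snd), hfs]
      exact List.length_filter_le _ _
    have h3 : L.length ≤ (encodeSeqs L).length := by
      have := length_le_length_encodeAll L
      rw [encodeSeqs_eq, List.length_cons]; omega
    rw [length_mergeStored] at ht₄
    omega

/-- The words and reals handed over, `5 + 3m` in number, are the encoded instance exactly. The real
array of the input is passed on as it is, since splitting `x` changes no weight. -/
theorem round_exec {L : List (List ℕ)} {t : ℕ} (h : State n m k x e₁ e₂ w W p acc σ) (hx : x < n)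
    (hp : 0 < p) (he₁ : ∀ j < m, e₁ j < n) (he₂ : ∀ j < m, e₂ j < n)
    (hO : O (splitInput n m k x p e₁ e₂ w) (encodeSeqs L) t) (hL : ∀ ws ∈ L, Valid n ws) :
    ∃ σ' t', Exec O round σ σ' t' [splitInput n m k x p e₁ e₂ w] ∧
      State n m k x e₁ e₂ w W (p + p) (update (pathWt (matWt n x W)) k p acc L) σ' ∧
      t' ≤ 32 * (n + m + acc.length + (encodeSeqs L).length) + t := by
  obtain ⟨σ₁, t₁, hE₁, h₁, hres, hseg, ht₁⟩ := beforeCall_runs (O := O) h hp he₁ he₂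
  have hlen : (splitInput n m k x p e₁ e₂ w).1.length = 5 + (m + m) := by
    simp [splitInput, List.length_flatMap]; omega
  have hin : σ₁.callInput 2 (.const 5 ⊹ (.var 2 ⊹ .var 2)) 0 (.var 2) =
      splitInput n m k x p e₁ e₂ w := by
    refine Prod.ext ?_ ?_
    · rw [← hseg.map_range, hlen]
      simp [Store.callInput, NExpr.eval, h₁.m_eq]
    · simp only [Store.callInput, NExpr.eval, h₁.m_eq, splitInput]
      exact List.map_congr_left fun j hj => h₁.wts_eq j (List.mem_range.1 hj)
  have hE₂ := Exec.call (O := O) (r := 3) (x := 12) (hin.symm ▸ hO)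
  rw [hin] at hE₂
  have h₂ := h₁.of_frame hE₂.frame (by decide) (by decide) (by decide)
  obtain ⟨σ₃, t₃, hE₃, h₃, ht₃⟩ := afterCall_runs (O := O) (L := L) h₂ hx (by simpa using hres)
    (by simp) (seg_of_get fun j hj => by simp [hj]) hL
  refine ⟨σ₃, _, .seq hE₁ (.seq hE₂ hE₃), h₃, ?_⟩
  have hw : (splitInput n m k x p e₁ e₂ w).2.length = m := by simp [splitInput]
  have hpos : 1 ≤ (encodeSeqs L).length := by simp [encodeSeqs]
  rw [hlen, hw]
  omega

/-- Since `hN` turns the loop test into `i < N`, this is an induction on the `d` rounds left. The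
bound `B` on the number of listed paths is kept apart from `T`, because it may come from `k` or from
the total output. -/
theorem loop_exec {Ls : ℕ → List (List ℕ)} {N B T : ℕ} {ts : ℕ → ℕ} (hx : x < n)
    (he₁ : ∀ j < m, e₁ j < n) (he₂ : ∀ j < m, e₂ j < n) (hN : ∀ i, 2 ^ i < n ↔ i < N)
    (hO : ∀ i < N, O (splitInput n m k x (2 ^ i) e₁ e₂ w) (encodeSeqs (Ls i)) (ts i))
    (hL : ∀ i < N, ∀ ws ∈ Ls i, Valid n ws)
    (hB : ∀ i < N, (lightest (pathWt (matWt n x W)) k Ls i).length ≤ B)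
    (hlen : ∀ i < N, (encodeSeqs (Ls i)).length ≤ T) (hts : ∀ i < N, ts i ≤ T) :
    ∀ d i, i + d = N → ∀ σ, State n m k x e₁ e₂ w W (2 ^ i)
      (lightest (pathWt (matWt n x W)) k Ls i) σ →
      ∃ σ' t', Exec O (.while (.lt (.var 5) (.var 1)) round) σ σ' t'
        ((List.range' i d).map fun i => splitInput n m k x (2 ^ i) e₁ e₂ w) ∧
        State n m k x e₁ e₂ w W (2 ^ N) (lightest (pathWt (matWt n x W)) k Ls N) σ' ∧
        t' ≤ (32 * (n + m + B + T) + T + 1) * d + 1 := by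
  intro d
  induction d with
  | zero =>
    rintro i rfl σ h
    refine ⟨σ, 1, .whileFalse ?_, h, by omega⟩
    have := (hN i).not.2 (by simp)
    simp [Test.holds, NExpr.eval, h.n_eq, h.p_eq]
    omega
  | succ d ih =>
    intro i hi σ h
    have hlt : i < N := by omega
    obtain ⟨σ₁, t₁, hE₁, h₁, ht₁⟩ := round_exec h hx (by positivity) he₁ he₂ (hO i hlt) (hL i hlt)
    rw [← two_mul, ← pow_succ'] at h₁
    obtain ⟨σ₂, t₂, hE₂, h₂, ht₂⟩ := ih (i + 1) (by omega) σ₁ h₁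
    refine ⟨σ₂, _, .whileTrue ?_ hE₁ hE₂, h₂, ?_⟩
    · simpa [Test.holds, NExpr.eval, h.n_eq, h.p_eq] using (hN i).2 hlt
    · have b1 := hB i hlt
      have b2 := hlen i hlt
      have b3 := hts i hlt
      have : t₁ ≤ 32 * (n + m + B + T) + T := ht₁.trans (by omega)
      rw [mul_add, mul_one]
      omega

theorem setup_runs {ω : ℕ → ℕ → ℝ} {d : Input} (hn : d.1.getD 0 0 = n) (hm : d.1.getD 1 0 = m)
    (hk : d.1.getD 2 0 = k) (hx : d.1.getD 3 0 = x)
    (h₁ : ∀ j < m, d.1.getD (4 + (j + j)) 0 = e₁ j) (h₂ : ∀ j < m, d.1.getD (5 + (j + j)) 0 = e₂ j)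
    (hw : ∀ j < m, d.2.getD j 0 = ω (e₁ j) (e₂ j)) (hω : ∀ u v, ω u v = ω v u)
    (he₁ : ∀ j < m, e₁ j < n) (he₂ : ∀ j < m, e₂ j < n) :
    Runs O setup (Store.init d) fun σ' t =>
      (∃ W : ℕ → ℝ, (∀ j < m, W (e₁ j * n + e₂ j) = ω (e₁ j) (e₂ j) ∧
        W (e₂ j * n + e₁ j) = ω (e₁ j) (e₂ j)) ∧
        State n m k x e₁ e₂ (fun j => ω (e₁ j) (e₂ j)) W 1 [] σ') ∧
      t ≤ 5 * n + 4 * m + 11 := by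
  have r1 : Runs O readHeader (Store.init d) fun σ' t => σ'.var 1 = n ∧ σ'.var 2 = m ∧
      σ'.var 3 = k ∧ σ'.var 4 = x ∧ t = 4 := by
    refine runs_seq (runs_setVar (runs_seq (runs_setVar (runs_seq (runs_setVar (runs_setVar ?_))))))
    simp only [NExpr.eval, Store.setVar_arr, Store.setVar_var, Store.init, hn, hm, hk, hx]
    simp
  refine runs_seq (r1.mono_frame ?_)
  rintro σ₁ _ hF₁ ⟨g1, g2, g3, g4, rfl⟩
  refine runs_seq ((makeTables_runs g1 g4).mono_frame ?_)
  rintro σ₂ t₂ hF₂ ⟨hmul, hcl, ht₂⟩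
  have i0 : σ₂.arr 0 = fun i => d.1.getD i 0 := by
    rw [hF₂.arr 0 (by decide), hF₁.arr 0 (by decide)]; simp [Store.init]
  have w0 : σ₂.wts 0 = fun i => d.2.getD i 0 := by
    rw [hF₂.wts 0 (by decide), hF₁.wts 0 (by decide)]; simp [Store.init]
  refine runs_seq ((makeMatrix_runs (ω := ω) ((hF₂.var 2 (by decide)).trans g2) hmul
    (by simpa only [i0] using h₁) (by simpa only [i0] using h₂) (by simpa only [w0] using hw)
    hω he₁ he₂).mono_frame ?_)
  rintro σ₃ t₃ hF₃ ⟨hW, ht₃⟩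
  refine runs_setVar ⟨⟨σ₃.wts 1, hW, ?_⟩, by omega⟩
  have v : ∀ y ∈ [1, 2, 3, 4], σ₃.var y = σ₁.var y := fun y hy => by
    rw [hF₃.var y (by revert y; decide), hF₂.var y (by revert y; decide)]
  have j0 : σ₃.arr 0 = fun i => d.1.getD i 0 := by rw [hF₃.arr 0 (by decide), i0]
  have u0 : σ₃.wts 0 = fun i => d.2.getD i 0 := by rw [hF₃.wts 0 (by decide), w0]
  have v7 : σ₃.var 7 = 0 := by
    rw [hF₃.var 7 (by decide), hF₂.var 7 (by decide), hF₁.var 7 (by decide)]; rfl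
  exact {
    n_eq := by simpa [g1] using v 1 (by simp)
    m_eq := by simpa [g2] using v 2 (by simp)
    k_eq := by simpa [g3] using v 3 (by simp)
    x_eq := by simpa [g4] using v 4 (by simp)
    p_eq := by simp [NExpr.eval]
    fst_eq := by rw [Store.setVar_arr, j0]; exact h₁
    snd_eq := by rw [Store.setVar_arr, j0]; exact h₂
    wts_eq := by rw [Store.setVar_wts, u0]; exact hw
    mul_eq := by rw [Store.setVar_arr, hF₃.arr 8 (by decide)]; exact hmul
    cl_eq := by rw [Store.setVar_arr, hF₃.arr 9 (by decide)]; exact hcl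
    mat_eq := rfl
    stored := ⟨[], rfl, by simp [v7], ⟨trivial, by simp⟩⟩ }

end

/-- Only the matrix entries at edges are specified, so `W` stays existential. The quantity `T`
bounds the time of each call and thereby the length of each output. -/
theorem program_halts {O : Algo} {n m k x N T : ℕ} {e₁ e₂ : ℕ → ℕ} {ω : ℕ → ℕ → ℝ} {d : Input}
    {Ls : ℕ → List (List ℕ)} {ts : ℕ → ℕ} (hn : d.1.getD 0 0 = n) (hm : d.1.getD 1 0 = m)
    (hk : d.1.getD 2 0 = k) (hx : d.1.getD 3 0 = x)
    (h₁ : ∀ j < m, d.1.getD (4 + (j + j)) 0 = e₁ j) (h₂ : ∀ j < m, d.1.getD (5 + (j + j)) 0 = e₂ j)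
    (hw : ∀ j < m, d.2.getD j 0 = ω (e₁ j) (e₂ j)) (hω : ∀ u v, ω u v = ω v u)
    (he₁ : ∀ j < m, e₁ j < n) (he₂ : ∀ j < m, e₂ j < n) (hxn : x < n)
    (hN : ∀ i, 2 ^ i < n ↔ i < N)
    (hO : ∀ i < N, O (splitInput n m k x (2 ^ i) e₁ e₂ fun j => ω (e₁ j) (e₂ j))
      (encodeSeqs (Ls i)) (ts i))
    (hL : ∀ i < N, ∀ ws ∈ Ls i, Valid n ws)
    (hlen : ∀ i < N, (encodeSeqs (Ls i)).length ≤ ts i) (hts : ∀ i < N, ts i ≤ T) :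
    ∃ W : ℕ → ℝ, (∀ j < m, W (e₁ j * n + e₂ j) = ω (e₁ j) (e₂ j) ∧
      W (e₂ j * n + e₁ j) = ω (e₁ j) (e₂ j)) ∧
      ∃ t, program.Halts O d
        (encodeSeqs ((lightest (pathWt (matWt n x W)) k Ls N).map fun ws => ws.map (coll n x))) t
        ((List.range N).map fun i => splitInput n m k x (2 ^ i) e₁ e₂ fun j => ω (e₁ j) (e₂ j)) ∧
      t ≤ 64 * (N * (min k (N * T) + T) + (N + 1) * (m + n)) := by
  obtain ⟨σ₁, t₁, hE₁, ⟨W, hW, hS₁⟩, ht₁⟩ :=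
    setup_runs (O := O) hn hm hk hx h₁ h₂ hw hω he₁ he₂
  have hlenT : ∀ i < N, (encodeSeqs (Ls i)).length ≤ T := fun i hi => (hlen i hi).trans (hts i hi)
  -- Truncation gives `k`; the count of all words reported so far gives `N * T`.
  have hB : ∀ i < N, (lightest (pathWt (matWt n x W)) k Ls i).length ≤ min k (N * T) := by
    refine fun i hi => le_min (length_lightest_le _ _ _ _) ?_
    refine (length_le_length_encodeAll _).trans ((length_encodeAll_lightest fun j hj =>
      hlenT j (by omega)).trans (Nat.mul_le_mul_right _ hi.le))
  obtain ⟨σ₂, t₂, hE₂, hS₂, ht₂⟩ := loop_exec (W := W) hxn he₁ he₂ hN hO hL hB hlenT hts N 0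
    (by omega) σ₁ hS₁
  obtain ⟨es, hes, h7, hst⟩ := hS₂.stored
  have hval := valid_lightest (wt := pathWt (matWt n x W)) (k := k) hL
  obtain ⟨σ₃, t₃, hE₃, hout, ht₃⟩ := writeOutput_runs (O := O) hS₂.cl_eq h7 hst fun e he =>
    (hval e.2 (by rw [← hes]; exact List.mem_map_of_mem he)).le
  rw [hes] at hout ht₃
  refine ⟨W, hW, _, ⟨σ₃, t₁ + (t₂ + t₃), ?_, hout.symm, rfl⟩, ?_⟩
  · have := Exec.seq hE₁ (.seq hE₂ hE₃)
    simpa [List.range_eq_range', program] using this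
  · have h4 := length_encodeAll_lightest (wt := pathWt (matWt n x W)) (k := k) hlenT
    have h5 : ((encodeSeqs ((lightest (pathWt (matWt n x W)) k Ls N).map
        fun ws => ws.map (coll n x)))).length ≤ N * T + 1 := by
      rw [encodeSeqs_eq, List.length_cons, length_encodeAll, List.map_map]
      rw [length_encodeAll] at h4
      simpa [Function.comp_def] using h4
    rw [encodeSeqs_eq, List.length_cons] at ht₃
    generalize min k (N * T) = M at *
    nlinarith

end CycleReduction

/-! ### Merging lists of lightest objects -/

/-- `l` lists `k` lightest elements of `U` (all of them if there are fewer than `k`) in nondecreasing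
order of weight. -/
structure LightestIn {β : Type} (U : Set β) (ω : β → ℝ) (k : ℕ) (l : List β) : Prop where
  nodup : l.Nodup
  sorted : l.Pairwise fun a b => ω a ≤ ω b
  length_le : l.length ≤ k
  mem : ∀ b ∈ l, b ∈ U
  lightest : ∀ b ∈ U, b ∉ l → l.length = k ∧ ∀ a ∈ l, ω a ≤ ω b

/-- If some `a` among the first `k` elements exceeded `r`, no element of `s` could come after the
first `k`, and none equals `a`. Then `s` would fit into the other at most `k - 1` places. -/
theorem le_of_mem_take {β : Type} {ω : β → ℝ} {l s : List β} {k : ℕ} {r : ℝ}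
    (hl : l.Pairwise fun a b => ω a ≤ ω b) (hs : s.Nodup) (hsl : s ⊆ l) (hk : k ≤ s.length)
    (hr : ∀ a ∈ s, ω a ≤ r) : ∀ a ∈ l.take k, ω a ≤ r := by
  classical
  intro a ha
  by_contra har
  have hsub : s ⊆ (l.take k).erase a := by
    intro b hb
    have hba : b ≠ a := by rintro rfl; exact har (hr _ hb)
    rw [List.mem_erase_of_ne hba]
    have hbl := hsl hb
    rw [← List.take_append_drop k l] at hl hbl
    rcases List.mem_append.1 hbl with h | h
    · exact h
    · exact absurd ((List.pairwise_append.1 hl).2.2 a ha b h |>.trans (hr b hb)) har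
  have h1 := (hs.subperm hsub).length_le
  rw [List.length_erase_of_mem ha, List.length_take] at h1
  have h2 : 0 < (l.take k).length := List.length_pos_of_mem ha
  rw [List.length_take] at h2
  omega

-- The filter makes the two merged lists disjoint, so nothing is repeated. It may also shorten `L`
-- below `k`; the case at the end shows that this is harmless.
open Classical in
theorem LightestIn.merge {β : Type} {U V : Set β} {ω : β → ℝ} {k : ℕ} {acc L : List β}
    (hacc : LightestIn U ω k acc) (hL : LightestIn V ω k L) :
    LightestIn (U ∪ V) ω k ((acc.merge (L.filter fun b => decide (b ∉ U))
      fun a b => decide (ω a ≤ ω b)).take k) := by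
  set M := acc.merge (L.filter fun b => decide (b ∉ U)) fun a b => decide (ω a ≤ ω b) with hM
  have hmem : ∀ b, b ∈ M ↔ b ∈ acc ∨ b ∈ L ∧ b ∉ U := fun b => by
    rw [hM, List.mem_merge, List.mem_filter]; simp
  have hperm : M.Perm (acc ++ L.filter fun b => decide (b ∉ U)) :=
    List.merge_perm_append _
  have hnodup : M.Nodup := by
    rw [hperm.nodup_iff, List.nodup_append]
    refine ⟨hacc.nodup, hL.nodup.filter _, ?_⟩
    rintro a ha b hb rfl
    rw [List.mem_filter] at hb
    exact (by simpa using hb.2 : a ∉ U) (hacc.mem _ ha)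
  have hsorted : M.Pairwise fun a b => ω a ≤ ω b := by
    have := List.pairwise_merge (le := fun a b => decide (ω a ≤ ω b))
      (fun a b c hab hbc => by simp only [decide_eq_true_eq] at *; exact hab.trans hbc)
      (fun a b => by simpa using le_total (ω a) (ω b)) acc (L.filter fun b => decide (b ∉ U))
      (by simpa using hacc.sorted) (by simpa using hL.sorted.filter _)
    simpa only [decide_eq_true_eq] using this
  refine ⟨hnodup.sublist (List.take_sublist _ _), hsorted.sublist (List.take_sublist _ _), by simp,
    fun b hb => ?_, fun b hb hbM => ?_⟩
  · rcases (hmem b).1 (List.mem_of_mem_take hb) with h | h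
    · exact .inl (hacc.mem b h)
    · exact .inr (hL.mem b h.1)
  -- To justify leaving out `b`, it suffices to find `k` distinct elements of the merged list that
  -- are no heavier than `b`.
  have full : ∀ s : List β, s.Nodup → s ⊆ M → s.length = k → (∀ a ∈ s, ω a ≤ ω b) →
      (M.take k).length = k ∧ ∀ a ∈ M.take k, ω a ≤ ω b := by
    intro s hs hsM hk hle
    have := (hs.subperm hsM).length_le
    exact ⟨by rw [List.length_take]; omega, le_of_mem_take hsorted hs hsM hk.ge hle⟩
  by_cases hbm : b ∈ M
  · have hd : b ∈ M.drop k := by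
      rw [← List.take_append_drop k M] at hbm
      exact (List.mem_append.1 hbm).resolve_left hbM
    have h1 := List.length_pos_of_mem hd
    rw [List.length_drop] at h1
    rw [← List.take_append_drop k M] at hsorted
    exact ⟨by rw [List.length_take]; omega,
      fun a ha => (List.pairwise_append.1 hsorted).2.2 a ha b hd⟩
  have haccM : acc ⊆ M := fun a ha => (hmem a).2 (.inl ha)
  by_cases hbU : b ∈ U
  · obtain ⟨h1, h2⟩ := hacc.lightest b hbU fun h => hbm (haccM h)
    exact full acc hacc.nodup haccM h1 h2
  obtain ⟨h1, h2⟩ := hL.lightest b (hb.resolve_left hbU) fun h => hbm ((hmem b).2 (.inr ⟨h, hbU⟩))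
  by_cases hall : L ⊆ M
  · exact full L hL.nodup hall h1 h2
  -- Here `L` is full and at most as heavy as `b`, but some `c` in it was filtered out and is not in
  -- `acc`. Then `acc` has `k` elements no heavier than `c`, hence no heavier than `b`.
  obtain ⟨c, hcL, hcM⟩ : ∃ c ∈ L, c ∉ M := by
    simpa [List.subset_def] using hall
  have hcU : c ∈ U := by
    by_contra hcU
    exact hcM ((hmem c).2 (.inr ⟨hcL, hcU⟩))
  obtain ⟨h3, h4⟩ := hacc.lightest c hcU fun h => hcM (haccM h)
  exact full acc hacc.nodup haccM h3 fun a ha => (h4 a ha).trans (h2 c hcL)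

/-! ### Bits -/

theorem Nat.mod_two_pow_add_self (a i : ℕ) :
    a % (2 ^ i + 2 ^ i) = a % 2 ^ i + if a.testBit i then 2 ^ i else 0 := by
  rw [← two_mul, ← pow_succ', Nat.mod_pow_succ, Nat.testBit_eq_decide_div_mod_eq]
  rcases Nat.mod_two_eq_zero_or_one (a / 2 ^ i) with h | h <;> simp [h]

theorem Nat.mod_two_pow_eq_iff (a b i : ℕ) :
    b % 2 ^ i = a % 2 ^ i ↔ ∀ j < i, a.testBit j = b.testBit j := by
  constructor
  · intro h j hj
    have := congrArg (fun y => y.testBit j) h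
    simpa [Nat.testBit_mod_two_pow, hj] using this.symm
  · intro h
    refine Nat.eq_of_testBit_eq fun j => ?_
    by_cases hj : j < i
    · simp [Nat.testBit_mod_two_pow, hj, h j hj]
    · simp [Nat.testBit_mod_two_pow, hj]

/-! ### Paths in the bit-sampled graph and cycles -/

/-- A path is determined by its edges. -/
theorem SimpleGraph.Walk.IsPath.eq_of_edges {V : Type*} {G : SimpleGraph V} {u v : V}
    {p q : G.Walk u v} (hp : p.IsPath) (hq : q.IsPath) (h : ∀ e, e ∈ p.edges ↔ e ∈ q.edges) :
    p = q := by
  induction p with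
  | nil =>
    cases q with
    | nil => rfl
    | @cons _ b _ h' q => simpa using (h s(_, b)).2 (List.mem_cons_self (a := s(_, b)))
  | @cons a b _ h₁ p ih =>
    cases q with
    | nil => simpa using (h s(a, b)).1 (by simp)
    | @cons _ b' _ h₂ q =>
      -- A path meets its start in its first edge only, so both paths begin with the same edge.
      have hb := hq.eq_snd_of_mem_edges ((h s(a, b)).1 (by simp))
      rw [snd_cons] at hb
      subst hb
      rw [cons_isPath_iff] at hp hq
      congr 1
      refine ih hp.1 hq.1 fun e => ?_
      have he := h e
      simp only [edges_cons, List.mem_cons] at he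
      constructor
      · intro hep
        refine (he.1 (.inr hep)).resolve_left ?_
        rintro rfl
        exact hp.2 (p.fst_mem_support_of_mem_edges hep)
      · intro heq
        refine (he.2 (.inr heq)).resolve_left ?_
        rintro rfl
        exact hq.2 (q.fst_mem_support_of_mem_edges heq)

namespace WGraph

variable {X : WGraph} {x : Fin X.n} {i : ℕ}

@[simp] theorem collapse_castSucc (u : Fin X.n) : X.collapse x u.castSucc = u := by
  simp [collapse]

@[simp] theorem collapse_last : X.collapse x (Fin.last X.n) = x := by
  simp [collapse]

theorem collapse_val (a : Fin (X.n + 1)) :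
    (X.collapse x a : ℕ) = CycleReduction.coll X.n x a := by
  refine Fin.lastCases ?_ (fun u => ?_) a
  · simp [CycleReduction.coll]
  · simp [CycleReduction.coll, u.isLt.ne]

theorem eq_of_collapse_eq {a b : Fin (X.n + 1)} (h : X.collapse x a = X.collapse x b)
    (ha : a ≠ x.castSucc) (hb : b ≠ x.castSucc) : a = b := by
  induction a using Fin.lastCases with
  | last =>
    induction b using Fin.lastCases with
    | last => rfl
    | cast v => simp only [collapse_last, collapse_castSucc] at h; exact absurd (by rw [h]) hb
  | cast u =>
    induction b using Fin.lastCases with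
    | last => simp only [collapse_last, collapse_castSucc] at h; exact absurd (by rw [h]) ha
    | cast v => simp only [collapse_castSucc] at h; rw [h]

theorem adj_iff {u v : Fin X.n} : X.G.Adj u v ↔ ∃ j, s((X.edge j).1, (X.edge j).2) = s(u, v) := by
  rw [← SimpleGraph.mem_edgeSet, ← X.edge_range, Set.mem_range]

/-- The bit-sampled graph, on the vertices `Fin (X.n + 1)`. -/
def splitG (X : WGraph) (x : Fin X.n) (i : ℕ) : SimpleGraph (Fin (X.n + 1)) := (X.split x i).G

/-- Redirection depends only on the original endpoints, so an edge of the split graph can be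
recovered from its image. This makes the identification of the copies injective on edges although it
is not injective on vertices. -/
theorem split_adj_iff {a b : Fin (X.n + 1)} : (X.splitG x i).Adj a b ↔
    X.G.Adj (X.collapse x a) (X.collapse x b) ∧
      a = X.redirect x i (X.collapse x a) (X.collapse x b) ∧
      b = X.redirect x i (X.collapse x b) (X.collapse x a) := by
  have h : (X.splitG x i).Adj a b ↔ ∃ j, s((X.splitEdge x i j).1, (X.splitEdge x i j).2) = s(a, b) :=
    adj_iff (X := X.split x i)
  rw [h, adj_iff]
  constructor
  · rintro ⟨j, hj⟩
    rw [Sym2.eq_iff] at hj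
    rcases hj with ⟨rfl, rfl⟩ | ⟨rfl, rfl⟩
    · exact ⟨⟨j, by simp [splitEdge, collapse_redirect]⟩, by simp [splitEdge, collapse_redirect],
        by simp [splitEdge, collapse_redirect]⟩
    · exact ⟨⟨j, by simp [splitEdge, collapse_redirect, Sym2.eq_swap]⟩,
        by simp [splitEdge, collapse_redirect], by simp [splitEdge, collapse_redirect]⟩
  · rintro ⟨⟨j, hj⟩, ha, hb⟩
    refine ⟨j, ?_⟩
    rw [Sym2.eq_iff] at hj
    rcases hj with ⟨h1, h2⟩ | ⟨h1, h2⟩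
    · rw [splitEdge, h1, h2, ← ha, ← hb]
    · rw [splitEdge, h1, h2, ← ha, ← hb, Sym2.eq_swap]

theorem redirect_of_ne {u v : Fin X.n} (h : u ≠ x) : X.redirect x i u v = u.castSucc := by
  simp [redirect, h]

theorem redirect_self (v : Fin X.n) :
    X.redirect x i x v = if (v : ℕ).testBit i then Fin.last X.n else x.castSucc := by
  simp [redirect]

/-- Identifying the two copies of `x` is a graph homomorphism. -/
def collapseHom (X : WGraph) (x : Fin X.n) (i : ℕ) : (X.splitG x i) →g X.G where
  toFun := X.collapse x
  map_rel' h := (split_adj_iff.1 h).1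

theorem collapse_edge_inj {e e' : Sym2 (Fin (X.n + 1))} (he : e ∈ (X.splitG x i).edgeSet)
    (he' : e' ∈ (X.splitG x i).edgeSet)
    (h : Sym2.map (X.collapse x) e = Sym2.map (X.collapse x) e') : e = e' := by
  induction e with | _ a b
  induction e' with | _ a' b'
  obtain ⟨-, ha, hb⟩ := split_adj_iff.1 ((SimpleGraph.mem_edgeSet _).1 he)
  obtain ⟨-, ha', hb'⟩ := split_adj_iff.1 ((SimpleGraph.mem_edgeSet _).1 he')
  simp only [Sym2.map_mk] at h
  rw [Sym2.eq_iff] at h ⊢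
  rcases h with ⟨h1, h2⟩ | ⟨h1, h2⟩
  · left; rw [ha, hb, ha', hb', h1, h2]; simp [collapse_redirect]
  · right; rw [ha, hb, ha', hb', h1, h2]; simp [collapse_redirect]

/-- The paths from `x₀` to `x₁` in the bit-sampled graph. -/
abbrev SplitPath (X : WGraph) (x : Fin X.n) (i : ℕ) : Type :=
  (X.splitG x i).Path (x.castSucc : Fin (X.n + 1)) (Fin.last X.n : Fin (X.n + 1))

/-- The closed walk that arises from a path from `x₀` to `x₁` when `x₀` and `x₁` are identified. -/
def SplitPath.closedWalk (p : X.SplitPath x i) : X.G.Walk x x :=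
  (p.1.map (X.collapseHom x i)).copy (collapse_castSucc x) collapse_last

namespace SplitPath

variable (p : X.SplitPath x i)

theorem support_closedWalk : p.closedWalk.support = p.1.support.map (X.collapse x) :=
  (SimpleGraph.Walk.support_copy _ _ _).trans (SimpleGraph.Walk.support_map _ _)

theorem edges_closedWalk : p.closedWalk.edges = p.1.edges.map (Sym2.map (X.collapse x)) :=
  (SimpleGraph.Walk.edges_copy _ _ _).trans (SimpleGraph.Walk.edges_map _ _)

theorem not_nil : ¬ p.1.Nil := by
  intro h
  exact (Fin.castSucc_lt_last x).ne h.eq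

/-- Distinct edges keep distinct images. Dropping the first vertex `x₀` leaves vertices on which the
identification is injective. Going back and forth along a single edge is excluded by the trail
condition. -/
theorem isCycle_closedWalk : p.closedWalk.IsCycle := by
  rw [SimpleGraph.Walk.isCycle_def, SimpleGraph.Walk.isTrail_def]
  refine ⟨?_, ?_, ?_⟩
  · rw [edges_closedWalk]
    refine p.2.isTrail.edges_nodup.map_on fun e he e' he' h => ?_
    exact collapse_edge_inj (p.1.edges_subset_edgeSet he) (p.1.edges_subset_edgeSet he') h
  · intro h
    have h1 : p.1.length = 0 := by
      have := congrArg (fun c => c.edges.length) h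
      simpa [edges_closedWalk] using this
    exact p.not_nil (SimpleGraph.Walk.length_eq_zero_iff.1 h1)
  · have hs := p.2.support_nodup
    rw [support_closedWalk, ← List.map_tail]
    rw [← SimpleGraph.Walk.cons_tail_support, List.nodup_cons] at hs
    refine hs.2.map_on fun a ha b hb h => eq_of_collapse_eq h ?_ ?_
    · rintro rfl; exact hs.1 ha
    · rintro rfl; exact hs.1 hb

/-- The cycle that arises from a path from `x₀` to `x₁`. -/
def toCycle : X.CycleAt x := ⟨p.closedWalk, p.isCycle_closedWalk⟩

theorem weight_toCycle : X.weight p.toCycle.1 = (X.split x i).weight p.1 := by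
  change (p.closedWalk.edges.map X.w).sum =
    (p.1.edges.map fun e => X.w (Sym2.map (X.collapse x) e)).sum
  rw [edges_closedWalk, List.map_map]
  rfl

theorem mem_edgeSet_toCycle {e : Sym2 (Fin X.n)} :
    e ∈ p.toCycle.edgeSet ↔ ∃ e' ∈ p.1.edges, Sym2.map (X.collapse x) e' = e := by
  simp [CycleAt.edgeSet, toCycle, edges_closedWalk]

/-- The images determine the edges and the edges determine the path. In particular, the two
directions of a cycle do not arise from two different paths of the same split graph. -/
theorem edgeSet_toCycle_injective :
    Function.Injective fun p : X.SplitPath x i => p.toCycle.edgeSet := by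
  have key : ∀ p q : X.SplitPath x i, p.toCycle.edgeSet = q.toCycle.edgeSet →
      ∀ e ∈ p.1.edges, e ∈ q.1.edges := by
    intro p q h e he
    obtain ⟨e', he', hee⟩ := q.mem_edgeSet_toCycle.1 (h ▸ p.mem_edgeSet_toCycle.2 ⟨e, he, rfl⟩)
    rwa [← collapse_edge_inj (q.1.edges_subset_edgeSet he') (p.1.edges_subset_edgeSet he) hee]
  exact fun p q h => Subtype.ext (p.2.eq_of_edges q.2 fun e => ⟨key p q h e, key q p h.symm e⟩)

/-- The edges at `x₀` are those towards neighbours with bit `0`, and the absence of loops at `x`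
rules out the other copy. -/
theorem snd_eq : p.1.snd = (X.collapse x p.1.snd).castSucc ∧
    (X.collapse x p.1.snd : ℕ).testBit i = false := by
  obtain ⟨h1, h2, h3⟩ := split_adj_iff.1 (p.1.adj_snd p.not_nil)
  rw [collapse_castSucc] at h1 h2 h3
  rw [redirect_of_ne h1.ne'] at h3
  refine ⟨h3, ?_⟩
  rw [redirect_self] at h2
  by_contra h
  rw [if_pos (by simpa using h)] at h2
  exact (Fin.castSucc_lt_last x).ne h2

theorem penultimate_eq : p.1.penultimate = (X.collapse x p.1.penultimate).castSucc ∧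
    (X.collapse x p.1.penultimate : ℕ).testBit i = true := by
  obtain ⟨h1, h2, h3⟩ := split_adj_iff.1 (p.1.adj_penultimate p.not_nil)
  rw [collapse_last] at h1 h2 h3
  rw [redirect_of_ne h1.ne] at h2
  refine ⟨h2, ?_⟩
  rw [redirect_self] at h3
  by_contra h
  rw [if_neg h] at h3
  exact (Fin.castSucc_lt_last x).ne' h3

/-- An edge at `x` comes from an edge at `x₀` or at `x₁`, and a path meets its ends only in its
first and its last edge. -/
theorem mem_edgeSet_iff (y : Fin X.n) : s(x, y) ∈ p.toCycle.edgeSet ↔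
    y = X.collapse x p.1.snd ∨ y = X.collapse x p.1.penultimate := by
  rw [mem_edgeSet_toCycle]
  constructor
  · have key : ∀ a b, s(a, b) ∈ p.1.edges → X.collapse x a = x → X.collapse x b = y →
        y = X.collapse x p.1.snd ∨ y = X.collapse x p.1.penultimate := by
      rintro a b he ha rfl
      induction a using Fin.lastCases with
      | last =>
        exact .inr (congrArg _ (p.2.eq_penultimate_of_mem_edges he))
      | cast u =>
        rw [collapse_castSucc] at ha
        subst ha
        exact .inl (congrArg _ (p.2.eq_snd_of_mem_edges he))
    rintro ⟨e, he, h⟩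
    induction e with | _ a b
    rw [Sym2.map_mk, Sym2.eq_iff] at h
    rcases h with ⟨h1, h2⟩ | ⟨h1, h2⟩
    · exact key a b he h1 h2
    · exact key b a (Sym2.eq_swap ▸ he) h2 h1
  · rintro (rfl | rfl)
    · exact ⟨s(_, p.1.snd), p.1.mk_start_snd_mem_edges p.not_nil, by simp⟩
    · exact ⟨s(p.1.penultimate, _), p.1.mk_penultimate_end_mem_edges p.not_nil,
        by simp [Sym2.eq_swap]⟩

end SplitPath

/-- Some two neighbours of `x` in the set `E` of edges differ in the `j`-th bit. -/
def Differ (X : WGraph) (x : Fin X.n) (j : ℕ) (E : Set (Sym2 (Fin X.n))) : Prop :=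
  ∃ y z : Fin X.n, s(x, y) ∈ E ∧ s(x, z) ∈ E ∧ (y : ℕ).testBit j ≠ (z : ℕ).testBit j

theorem SplitPath.differ_iff (p : X.SplitPath x i) (j : ℕ) : X.Differ x j p.toCycle.edgeSet ↔
    (X.collapse x p.1.snd : ℕ).testBit j ≠ (X.collapse x p.1.penultimate : ℕ).testBit j := by
  constructor
  · rintro ⟨y, z, hy, hz, h⟩
    rw [p.mem_edgeSet_iff] at hy hz
    rcases hy with rfl | rfl <;> rcases hz with rfl | rfl
    · exact absurd rfl h
    · exact h
    · exact h.symm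
    · exact absurd rfl h
  · exact fun h => ⟨_, _, (p.mem_edgeSet_iff _).2 (.inl rfl), (p.mem_edgeSet_iff _).2 (.inr rfl), h⟩

/-- A path ending in `x` meets `x` nowhere else, so all earlier vertices keep their labels and only
the last edge is redirected; by its bit it goes to `x₁`. Starting away from `x`, the lift avoids
`x₀`. -/
theorem exists_lift {a : Fin X.n} (p : X.G.Walk a x) (hp : p.IsPath) (ha : a ≠ x)
    (hb : (p.penultimate : ℕ).testBit i = true) :
    ∃ q : (X.splitG x i).Walk (a.castSucc : Fin (X.n + 1)) (Fin.last X.n : Fin (X.n + 1)),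
      q.IsPath ∧ x.castSucc ∉ q.support ∧
      q.support.map (X.collapse x) = p.support ∧
      q.edges.map (Sym2.map (X.collapse x)) = p.edges := by
  induction p with
  | nil => exact absurd rfl ha
  | @cons a b x h p ih =>
    rw [SimpleGraph.Walk.cons_isPath_iff] at hp
    by_cases hbx : b = x
    · subst hbx
      obtain rfl := (SimpleGraph.Walk.isPath_iff_nil.1 hp.1).eq_nil
      have hadj : (X.splitG b i).Adj (a.castSucc : Fin (X.n + 1)) (Fin.last X.n) := by
        rw [split_adj_iff, collapse_castSucc, collapse_last, redirect_of_ne ha, redirect_self]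
        exact ⟨h, rfl, by rw [if_pos (by simpa using hb)]⟩
      refine ⟨.cons hadj .nil, ?_, ?_, ?_, ?_⟩
      · simp
      · simp [ha.symm, (Fin.castSucc_lt_last b).ne]
      · simp
      · simp
    · have hnil : ¬ p.Nil := fun hn => hbx hn.eq
      rw [SimpleGraph.Walk.penultimate_cons_of_not_nil _ _ hnil] at hb
      obtain ⟨q, hq, hx, hs, he⟩ := ih hp.1 hbx hb
      have hadj : (X.splitG x i).Adj (a.castSucc : Fin (X.n + 1)) b.castSucc := by
        rw [split_adj_iff, collapse_castSucc, collapse_castSucc, redirect_of_ne ha,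
          redirect_of_ne hbx]
        exact ⟨h, rfl, rfl⟩
      refine ⟨.cons hadj q, (SimpleGraph.Walk.cons_isPath_iff _ _).2 ⟨hq, fun hmem => hp.2 ?_⟩,
        ?_, ?_, ?_⟩
      · rw [← hs]
        exact List.mem_map.2 ⟨_, hmem, by simp⟩
      · simp [ha.symm, hx]
      · simp [hs]
      · simp [he]

theorem exists_toCycle_of_bits {c : X.G.Walk x x} (hc : c.IsCycle)
    (h₁ : (c.snd : ℕ).testBit i = false) (h₂ : (c.penultimate : ℕ).testBit i = true) :
    ∃ p : X.SplitPath x i, p.toCycle.edgeSet = {e | e ∈ c.edges} := by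
  cases c with
  | nil => exact absurd hc (by simp)
  | @cons _ a _ h p =>
    have hax : a ≠ x := h.ne'
    have hnil : ¬ p.Nil := fun hn => hax hn.eq
    rw [SimpleGraph.Walk.snd_cons] at h₁
    rw [SimpleGraph.Walk.penultimate_cons_of_not_nil _ _ hnil] at h₂
    obtain ⟨q, hq, hx, -, he⟩ := exists_lift p ((SimpleGraph.Walk.cons_isCycle_iff _ _).1 hc).1
      hax h₂
    have hadj : (X.splitG x i).Adj (x.castSucc : Fin (X.n + 1)) a.castSucc := by
      rw [split_adj_iff, collapse_castSucc, collapse_castSucc, redirect_of_ne hax, redirect_self,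
        if_neg (by simp [h₁])]
      exact ⟨h, rfl, rfl⟩
    refine ⟨⟨.cons hadj q, (SimpleGraph.Walk.cons_isPath_iff _ _).2 ⟨hq, hx⟩⟩, Set.ext fun e => ?_⟩
    rw [SplitPath.mem_edgeSet_toCycle]
    simp [← he, eq_comm]

theorem mem_edges_iff_of_isCycle {c : X.G.Walk x x} (hc : c.IsCycle) (y : Fin X.n) :
    s(x, y) ∈ c.edges ↔ y = c.snd ∨ y = c.penultimate := by
  cases c with
  | nil => exact absurd hc (by simp)
  | @cons _ a _ h p =>
    have hax : a ≠ x := h.ne'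
    have hnil : ¬ p.Nil := fun hn => hax hn.eq
    have hp := ((SimpleGraph.Walk.cons_isCycle_iff _ _).1 hc).1
    rw [SimpleGraph.Walk.snd_cons, SimpleGraph.Walk.penultimate_cons_of_not_nil _ _ hnil,
      SimpleGraph.Walk.edges_cons, List.mem_cons]
    refine or_congr (by simp [hax.symm]) ⟨fun h' => hp.eq_penultimate_of_mem_edges (Sym2.eq_swap ▸ h'), ?_⟩
    rintro rfl
    rw [Sym2.eq_swap]
    exact p.mk_penultimate_end_mem_edges hnil

/-- If the second vertex of the cycle has bit `1`, the reversed cycle, which has the same edges, is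
lifted instead. -/
theorem exists_toCycle (c : X.CycleAt x) (h : X.Differ x i c.edgeSet) :
    ∃ p : X.SplitPath x i, p.toCycle.edgeSet = c.edgeSet := by
  obtain ⟨c, hc⟩ := c
  obtain ⟨y, z, hy, hz, hyz⟩ := h
  have hne : (c.snd : ℕ).testBit i ≠ (c.penultimate : ℕ).testBit i := by
    have hy' := (mem_edges_iff_of_isCycle hc y).1 hy
    have hz' := (mem_edges_iff_of_isCycle hc z).1 hz
    rcases hy' with rfl | rfl <;> rcases hz' with rfl | rfl
    · exact absurd rfl hyz
    · exact hyz
    · exact hyz.symm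
    · exact absurd rfl hyz
  cases hb : (c.snd : ℕ).testBit i with
  | false =>
    exact exists_toCycle_of_bits hc hb (by rw [hb] at hne; simpa using hne.symm)
  | true =>
    obtain ⟨p, hp⟩ := exists_toCycle_of_bits (i := i) hc.reverse
      (by rw [SimpleGraph.Walk.snd_reverse]; rw [hb] at hne; simpa using hne.symm)
      (by rwa [SimpleGraph.Walk.penultimate_reverse])
    exact ⟨p, by rw [hp]; simp [CycleAt.edgeSet]⟩

end WGraph

namespace WGraph

open CycleReduction

variable {X : WGraph} {x : Fin X.n} {i : ℕ}

/-! ### The input of the reduction and of the subroutine -/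

/-- The first endpoint of the edge `j`. -/
def fstWord (X : WGraph) (j : ℕ) : ℕ := if h : j < X.m then (X.edge ⟨j, h⟩).1 else 0

/-- The second endpoint of the edge `j`. -/
def sndWord (X : WGraph) (j : ℕ) : ℕ := if h : j < X.m then (X.edge ⟨j, h⟩).2 else 0

/-- The weight of the pair of the labels `u` and `v`. -/
noncomputable def wordWeight (X : WGraph) (u v : ℕ) : ℝ :=
  if h : u < X.n ∧ v < X.n then X.w s(⟨u, h.1⟩, ⟨v, h.2⟩) else 0

theorem fstWord_val (j : Fin X.m) : X.fstWord j = (X.edge j).1 := by simp [fstWord]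

theorem sndWord_val (j : Fin X.m) : X.sndWord j = (X.edge j).2 := by simp [sndWord]

theorem wordWeight_val (u v : Fin X.n) : X.wordWeight u v = X.w s(u, v) := by simp [wordWeight]

theorem wordWeight_comm (u v : ℕ) : X.wordWeight u v = X.wordWeight v u := by
  simp only [wordWeight, and_comm (a := u < X.n)]
  split_ifs
  · rw [Sym2.eq_swap]
  · rfl

theorem fstWord_lt {j : ℕ} (hj : j < X.m) : X.fstWord j < X.n := by simp [fstWord, hj]

theorem sndWord_lt {j : ℕ} (hj : j < X.m) : X.sndWord j < X.n := by simp [sndWord, hj]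

theorem edgeWords_eq : X.edgeWords =
    (List.range X.m).flatMap fun j => [X.fstWord j, X.sndWord j] := by
  rw [← List.map_coe_finRange_eq_range, List.flatMap_map]
  simp only [fstWord_val, sndWord_val, edgeWords]

theorem edgeWeights_eq : X.edgeWeights =
    (List.range X.m).map fun j => X.wordWeight (X.fstWord j) (X.sndWord j) := by
  rw [← List.map_coe_finRange_eq_range, List.map_map]
  simp only [edgeWeights, Function.comp_def, fstWord_val, sndWord_val, wordWeight_val]

theorem getD_flatMap_pair (a b : ℕ → ℕ) {m j : ℕ} (hj : j < m) :
    ((List.range m).flatMap fun j => [a j, b j]).getD (j + j) 0 = a j ∧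
    ((List.range m).flatMap fun j => [a j, b j]).getD (j + j + 1) 0 = b j := by
  induction m with
  | zero => omega
  | succ m ih =>
    have hlen : ((List.range m).flatMap fun j => [a j, b j]).length = m + m := by
      simp [List.length_flatMap]; omega
    rw [List.range_succ, List.flatMap_append, List.flatMap_singleton]
    rcases Nat.lt_succ_iff_lt_or_eq.1 hj with h | rfl
    · rw [List.getD_append _ _ _ _ (by omega), List.getD_append _ _ _ _ (by omega)]
      exact ih h
    · rw [List.getD_append_right _ _ _ _ (by omega), List.getD_append_right _ _ _ _ (by omega)]
      simp [hlen]

theorem redirectWord_val (u v : Fin X.n) :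
    redirectWord X.n x (2 ^ i) u v = (X.redirect x i u v : ℕ) := by
  have h : 2 ^ i ≤ (v : ℕ) % (2 ^ i + 2 ^ i) ↔ (v : ℕ).testBit i = true := by
    rw [Nat.mod_two_pow_add_self]
    have := Nat.mod_lt (v : ℕ) (Nat.two_pow_pos i)
    split_ifs with hb
    · simp [hb]
    · exact ⟨fun h => by omega, fun h => absurd h hb⟩
  simp only [redirectWord, redirect, h, Fin.val_inj]
  split_ifs <;> simp

/-- The weight list is that of the original graph, because identifying the copies undoes the
redirection of each edge. -/
theorem enc_sampled (I : KSiSCInst) (i : ℕ) : kSiSP.enc (I.sampled i) =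
    splitInput I.X.n I.X.m I.k I.x (2 ^ i) I.X.fstWord I.X.sndWord
      fun j => I.X.wordWeight (I.X.fstWord j) (I.X.sndWord j) := by
  refine Prod.ext ?_ ?_
  · simp only [splitInput, ← List.map_coe_finRange_eq_range, List.flatMap_map, fstWord_val,
      sndWord_val, redirectWord_val]
    rfl
  · simp only [splitInput, ← List.map_coe_finRange_eq_range, List.map_map, Function.comp_def,
      fstWord_val, sndWord_val, wordWeight_val]
    change (List.finRange I.X.m).map (fun j => I.X.w (Sym2.map (I.X.collapse I.x)
      s((I.X.splitEdge I.x i j).1, (I.X.splitEdge I.x i j).2))) = _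
    simp only [map_splitEdge]

/-! ### Weights -/

theorem pathWt_cons_cons (f : ℕ → ℕ → ℝ) (u v : ℕ) (l : List ℕ) :
    pathWt f (u :: v :: l) = f u v + pathWt f (v :: l) := by
  simp only [pathWt, List.length_cons, Nat.add_sub_cancel]
  rw [Finset.sum_range_succ', add_comm]
  simp

theorem pathWt_support {N : ℕ} {G : SimpleGraph (Fin N)} {u v : Fin N} (p : G.Walk u v)
    {f : ℕ → ℕ → ℝ} {g : Sym2 (Fin N) → ℝ} (hfg : ∀ a b, G.Adj a b → f a b = g s(a, b)) :
    pathWt f (p.support.map Fin.val) = (p.edges.map g).sum := by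
  induction p with
  | nil => simp [pathWt]
  | @cons a b _ h p ih =>
    rw [SimpleGraph.Walk.support_cons, SimpleGraph.Walk.edges_cons, List.map_cons, List.map_cons,
      List.sum_cons, ← ih, ← hfg a b h]
    rw [← SimpleGraph.Walk.cons_tail_support, List.map_cons, pathWt_cons_cons]

open Classical in
/-- The total weight of the edges in `E`. -/
noncomputable def setWeight (X : WGraph) (E : Set (Sym2 (Fin X.n))) : ℝ :=
  ∑ e with e ∈ E, X.w e

/-- A cycle repeats no edge, so its weight depends on its edge set alone, and lightest cycles can be
treated as lightest edge sets. -/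
theorem weight_eq_setWeight (c : X.CycleAt x) : X.weight c.1 = X.setWeight c.edgeSet := by
  classical
  rw [weight, ← List.sum_toFinset _ c.2.1.1.edges_nodup, setWeight]
  refine Finset.sum_congr ?_ fun _ _ => rfl
  ext e
  rw [List.mem_toFinset, Finset.mem_filter]
  exact ⟨fun h => ⟨Finset.mem_univ e, h⟩, fun h => h.2⟩

/-- The vertex labels along a path. -/
def SplitPath.words (p : X.SplitPath x i) : List ℕ := p.1.support.map Fin.val

theorem SplitPath.pathWt_words (p : X.SplitPath x i) {W : ℕ → ℝ}
    (hW : ∀ j < X.m,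
      W (X.fstWord j * X.n + X.sndWord j) = X.wordWeight (X.fstWord j) (X.sndWord j) ∧
      W (X.sndWord j * X.n + X.fstWord j) = X.wordWeight (X.fstWord j) (X.sndWord j)) :
    pathWt (matWt X.n x W) p.words = X.setWeight p.toCycle.edgeSet := by
  rw [← weight_eq_setWeight, weight, toCycle, edges_closedWalk, List.map_map]
  refine pathWt_support p.1 fun a b hab => ?_
  obtain ⟨j, hj⟩ := adj_iff.1 (split_adj_iff.1 hab).1
  obtain ⟨h1, h2⟩ := hW j j.2
  rw [fstWord_val, sndWord_val, wordWeight_val, hj] at h1 h2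
  rw [matWt, ← collapse_val, ← collapse_val]
  rw [Sym2.eq_iff] at hj
  rcases hj with ⟨e1, e2⟩ | ⟨e1, e2⟩
  · rw [e1, e2] at h1; exact h1
  · rw [e1, e2] at h2; exact h2

/-! ### The words of a path -/

theorem SplitPath.length_words (p : X.SplitPath x i) : p.words.length = p.1.length + 1 := by
  simp [words]

theorem SplitPath.length_pos (p : X.SplitPath x i) : 0 < p.1.length :=
  SimpleGraph.Walk.not_nil_iff_lt_length.1 p.not_nil

theorem SplitPath.words_getD_one (p : X.SplitPath x i) :
    p.words.getD 1 0 = X.collapse x p.1.snd := by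
  have h := p.length_pos
  have h' : 1 < p.1.support.length := by rw [SimpleGraph.Walk.length_support]; omega
  have hs : (p.1.snd : ℕ) = X.collapse x p.1.snd := congrArg Fin.val p.snd_eq.1
  rw [← hs, words, List.getD_eq_getElem _ _ (by simpa using h), List.getElem_map,
    SimpleGraph.Walk.support_getElem_one]

theorem SplitPath.words_getD_last (p : X.SplitPath x i) :
    p.words.getD (p.words.length - 2) 0 = X.collapse x p.1.penultimate := by
  have h := p.length_pos
  have hs : (p.1.penultimate : ℕ) = X.collapse x p.1.penultimate :=
    congrArg Fin.val p.penultimate_eq.1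
  rw [length_words, show p.1.length + 1 - 2 = p.1.length - 1 by omega, ← hs, words,
    List.getD_eq_getElem _ _ (by simp), List.getElem_map,
    SimpleGraph.Walk.support_getElem_length_sub_one_eq_penultimate]

theorem SplitPath.valid_words (p : X.SplitPath x i) : Valid X.n p.words where
  two_le := by have := p.length_pos; rw [length_words]; omega
  le w hw := by
    obtain ⟨a, -, rfl⟩ := List.mem_map.1 hw
    exact Nat.lt_succ_iff.1 a.2
  fst_lt := by rw [words_getD_one]; exact Fin.is_lt _
  lst_lt := by rw [words_getD_last]; exact Fin.is_lt _

/-- The inner neighbours of `x₀` and `x₁` have `i`-th bits `0` and `1`. So their residues modulo `2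
^ (i + 1)` differ by exactly `2 ^ i` when all lower bits agree. -/
theorem SplitPath.isLowest_words (p : X.SplitPath x i) :
    isLowest (2 ^ i) p.words = true ↔ ∀ j < i, ¬ X.Differ x j p.toCycle.edgeSet := by
  rw [isLowest, decide_eq_true_iff, words_getD_one, words_getD_last, Nat.mod_two_pow_add_self,
    Nat.mod_two_pow_add_self, p.snd_eq.2, p.penultimate_eq.2]
  simp only [if_true, Bool.false_eq_true, if_false, add_zero, Nat.add_right_cancel_iff,
    Nat.mod_two_pow_eq_iff, p.differ_iff, not_not]

theorem SplitPath.map_coll_words (p : X.SplitPath x i) :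
    p.words.map (coll X.n x) = p.toCycle.1.support.map Fin.val := by
  rw [toCycle, support_closedWalk, words, List.map_map, List.map_map]
  exact List.map_congr_left fun a _ => (collapse_val a).symm

/-! ### Lightest cycles -/

/-- The cycles through `x` whose two edges at `x` lead to vertices that differ in one of the first `i`
bits. -/
def cyclesBelow (X : WGraph) (x : Fin X.n) (i : ℕ) : Set (Set (Sym2 (Fin X.n))) :=
  {E | (∃ c : X.CycleAt x, c.edgeSet = E) ∧ ∃ j < i, X.Differ x j E}

/-- The cycles through `x` whose two edges at `x` lead to vertices that differ in the `i`-th bit. -/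
def cyclesAt (X : WGraph) (x : Fin X.n) (i : ℕ) : Set (Set (Sym2 (Fin X.n))) :=
  {E | (∃ c : X.CycleAt x, c.edgeSet = E) ∧ X.Differ x i E}

theorem cyclesBelow_succ : X.cyclesBelow x (i + 1) = X.cyclesBelow x i ∪ X.cyclesAt x i := by
  ext E
  simp only [cyclesBelow, cyclesAt, Set.mem_ofPred_eq, Set.mem_union, ← and_or_left]
  refine and_congr_right fun _ => ⟨?_, ?_⟩
  · rintro ⟨j, hj, h⟩
    rcases Nat.lt_succ_iff_lt_or_eq.1 hj with h' | rfl
    · exact .inl ⟨j, h', h⟩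
    · exact .inr h
  · rintro (⟨j, hj, h⟩ | h)
    · exact ⟨j, by omega, h⟩
    · exact ⟨i, by omega, h⟩

/-- The two neighbours of `x` on a cycle are distinct, and labels below `2 ^ N` can only differ in
the first `N` bits: after `N` rounds every cycle has been taken into account. -/
theorem edgeSet_mem_cyclesBelow {N : ℕ} (hN : X.n ≤ 2 ^ N) (c : X.CycleAt x) :
    c.edgeSet ∈ X.cyclesBelow x N := by
  refine ⟨⟨c, rfl⟩, ?_⟩
  have hne : (c.1.snd : ℕ) ≠ c.1.penultimate := fun h =>
    c.2.snd_ne_penultimate (Fin.val_injective h)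
  obtain ⟨j, hj⟩ : ∃ j, (c.1.snd : ℕ).testBit j ≠ (c.1.penultimate : ℕ).testBit j := by
    by_contra! h
    exact hne (Nat.eq_of_testBit_eq h)
  refine ⟨j, ?_, c.1.snd, c.1.penultimate, (mem_edges_iff_of_isCycle c.2 _).2 (.inl rfl),
    (mem_edges_iff_of_isCycle c.2 _).2 (.inr rfl), hj⟩
  by_contra hle
  have hlt : ∀ y : Fin X.n, (y : ℕ) < 2 ^ j := fun y =>
    y.2.trans_le (hN.trans (Nat.pow_le_pow_right two_pos (by omega)))
  rw [Nat.testBit_eq_false_of_lt (hlt _), Nat.testBit_eq_false_of_lt (hlt _)] at hj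
  exact hj rfl

theorem lightestIn_of_paths {k : ℕ} {l : List (X.SplitPath x i)}
    (h : IsKLightest id (fun p : X.SplitPath x i => (X.split x i).weight p.1) k l) :
    LightestIn (X.cyclesAt x i) X.setWeight k (l.map fun p => p.toCycle.edgeSet) := by
  obtain ⟨h1, h2, h3, h4, h5⟩ := h
  rw [List.map_id] at h1 h4 h5
  have hw : ∀ p : X.SplitPath x i, (X.split x i).weight p.1 = X.setWeight p.toCycle.edgeSet :=
    fun p => by rw [← weight_eq_setWeight, p.weight_toCycle]
  simp only [hw] at h2 h5
  refine ⟨h1.map SplitPath.edgeSet_toCycle_injective, List.pairwise_map.2 h2, by simpa using h3,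
    ?_, ?_⟩
  · intro E hE
    obtain ⟨p, -, rfl⟩ := List.mem_map.1 hE
    exact ⟨⟨_, rfl⟩, (p.differ_iff i).2 (by rw [p.snd_eq.2, p.penultimate_eq.2]; simp)⟩
  · rintro E ⟨⟨c, rfl⟩, hd⟩ hE
    obtain ⟨p, hp⟩ := exists_toCycle c hd
    rw [← hp] at hE ⊢
    have hpl : p ∉ l := fun hpl => hE (List.mem_map_of_mem hpl)
    refine ⟨?_, ?_⟩
    · rw [List.length_map]
      exact le_antisymm h3 (not_lt.1 fun hlt => hpl (h4 hlt p))
    · intro E' hE'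
      obtain ⟨p', hp', rfl⟩ := List.mem_map.1 hE'
      exact h5 p hpl p' hp'

/-- The program merges word lists by computed weight, whereas `LightestIn.merge` concerns edge sets.
Pairing each word list with its cycle shows both merges as images of one merge of pairs, since the
weights agree on both sides. -/
theorem exists_lightest {k : ℕ} {W : ℕ → ℝ} {Ls : ℕ → List (List ℕ)} {N : ℕ}
    (hW : ∀ j < X.m,
      W (X.fstWord j * X.n + X.sndWord j) = X.wordWeight (X.fstWord j) (X.sndWord j) ∧
      W (X.sndWord j * X.n + X.fstWord j) = X.wordWeight (X.fstWord j) (X.sndWord j))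
    (h : ∀ i < N, ∃ l : List (X.SplitPath x i),
      IsKLightest id (fun p : X.SplitPath x i => (X.split x i).weight p.1) k l ∧
      Ls i = l.map SplitPath.words) :
    ∃ q : List (List ℕ × X.CycleAt x),
      q.map Prod.fst = lightest (pathWt (matWt X.n x W)) k Ls N ∧
      (∀ r ∈ q, r.1.map (coll X.n x) = r.2.1.support.map Fin.val ∧
        pathWt (matWt X.n x W) r.1 = X.setWeight r.2.edgeSet) ∧
      LightestIn (X.cyclesBelow x N) X.setWeight k (q.map fun r => r.2.edgeSet) := by
  classical
  induction N with
  | zero =>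
    refine ⟨[], rfl, by simp, ⟨by simp, by simp, by simp, by simp, ?_⟩⟩
    rintro E ⟨-, j, hj, -⟩
    omega
  | succ N ih =>
    obtain ⟨q, hq, hrel, hlight⟩ := ih fun i hi => h i (by omega)
    obtain ⟨l, hl, hLs⟩ := h N (by omega)
    set L := l.map fun p => (p.words, p.toCycle) with hL
    have hrelL : ∀ r ∈ L, r.1.map (coll X.n x) = r.2.1.support.map Fin.val ∧
        pathWt (matWt X.n x W) r.1 = X.setWeight r.2.edgeSet := by
      intro r hr
      obtain ⟨p, -, rfl⟩ := List.mem_map.1 hr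
      exact ⟨p.map_coll_words, p.pathWt_words hW⟩
    -- The residue test of the round rejects exactly the cycles that already belong to the earlier
    -- bits.
    have hlow : ∀ r ∈ L, isLowest (2 ^ N) r.1 = decide (r.2.edgeSet ∉ X.cyclesBelow x N) := by
      intro r hr
      obtain ⟨p, -, rfl⟩ := List.mem_map.1 hr
      rw [Bool.eq_iff_iff, decide_eq_true_iff, p.isLowest_words]
      exact ⟨fun h ⟨_, j, hj, hd⟩ => h j hj hd, fun h j hj hd => h ⟨⟨_, rfl⟩, j, hj, hd⟩⟩
    have hfst : Ls N = L.map Prod.fst := by simp [hL, hLs, Function.comp_def]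
    have hkey : (l.map fun p => p.toCycle.edgeSet) = L.map fun r => r.2.edgeSet := by
      simp [hL, Function.comp_def]
    clear_value L
    refine ⟨(q.merge (L.filter fun r => isLowest (2 ^ N) r.1) fun r s =>
      decide (pathWt (matWt X.n x W) r.1 ≤ pathWt (matWt X.n x W) s.1)).take k, ?_, ?_, ?_⟩
    · rw [List.map_take, List.map_merge (s := fun a b =>
        decide (pathWt (matWt X.n x W) a ≤ pathWt (matWt X.n x W) b)) (by simp), hq, lightest,
        update, hfst, List.filter_map]
      rfl
    · intro r hr
      rcases List.mem_merge.1 (List.mem_of_mem_take hr) with hr | hr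
      · exact hrel r hr
      · exact hrelL r (List.mem_of_mem_filter hr)
    · have hm := hlight.merge (lightestIn_of_paths hl)
      rw [← cyclesBelow_succ] at hm
      rw [List.map_take, List.map_merge (s := fun a b =>
        decide (X.setWeight a ≤ X.setWeight b)) ?_]
      · rw [hkey, List.filter_map] at hm
        rwa [List.filter_congr hlow]
      · intro a ha b hb
        rw [(hrel a ha).2, (hrelL b (List.mem_of_mem_filter hb)).2]

theorem correct_of_lightest {k N : ℕ} {W : ℕ → ℝ} {Ls : ℕ → List (List ℕ)} (hN : X.n ≤ 2 ^ N)
    (hW : ∀ j < X.m,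
      W (X.fstWord j * X.n + X.sndWord j) = X.wordWeight (X.fstWord j) (X.sndWord j) ∧
      W (X.sndWord j * X.n + X.fstWord j) = X.wordWeight (X.fstWord j) (X.sndWord j))
    (h : ∀ i < N, ∃ l : List (X.SplitPath x i),
      IsKLightest id (fun p : X.SplitPath x i => (X.split x i).weight p.1) k l ∧
      Ls i = l.map SplitPath.words) :
    ∃ l : List (X.CycleAt x),
      IsKLightest WGraph.CycleAt.edgeSet (fun c => X.weight c.1) k l ∧
      (lightest (pathWt (matWt X.n x W)) k Ls N).map (fun ws => ws.map (coll X.n x)) =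
        l.map fun c => c.1.support.map Fin.val := by
  obtain ⟨q, hq, hrel, hlight⟩ := exists_lightest hW h
  have hmap : (q.map Prod.snd).map CycleAt.edgeSet = q.map fun r => r.2.edgeSet := by
    simp [Function.comp_def]
  refine ⟨q.map Prod.snd, ⟨?_, ?_, ?_, ?_, ?_⟩, ?_⟩
  · rw [hmap]; exact hlight.nodup
  · have := hlight.sorted
    rw [← hmap, List.pairwise_map] at this
    simpa only [weight_eq_setWeight] using this
  · simpa using hlight.length_le
  · intro hlt c
    rw [hmap]
    by_contra hc
    have := (hlight.lightest _ (edgeSet_mem_cyclesBelow hN c) hc).1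
    simp only [List.length_map] at this hlt
    omega
  · intro c hc b hb
    rw [hmap] at hc
    simp only [weight_eq_setWeight]
    refine (hlight.lightest _ (edgeSet_mem_cyclesBelow hN c) hc).2 _ ?_
    rw [← hmap]
    exact List.mem_map_of_mem hb
  · rw [← hq, List.map_map, List.map_map]
    exact List.map_congr_left fun r hr => (hrel r hr).1

end WGraph

/-! ### Assembling the reduction and its time bounds -/

open CycleReduction in
/-- Running time and correctness of the reduction, where `T` bounds the running time of the subroutine
on the bit-sampled instances. -/
theorem CycleReduction.program_spec {A : Algo} (hA : A.IsAlgorithm) (I : KSiSCInst) {T : ℕ}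
    (h : ∀ i < Nat.clog 2 I.X.n, ∃ out t, A (kSiSP.enc (I.sampled i)) out t ∧
      kSiSP.Correct (I.sampled i) out ∧ t ≤ T) :
    ∃ out t, program.Halts A (kSiSC.enc I) out t
        ((List.range (Nat.clog 2 I.X.n)).map fun i => kSiSP.enc (I.sampled i)) ∧
      kSiSC.Correct I out ∧
      t ≤ 64 * (Nat.clog 2 I.X.n * (min I.k (Nat.clog 2 I.X.n * T) + T) +
        (Nat.clog 2 I.X.n + 1) * (I.X.m + I.X.n)) := by
  have h' : ∀ i, ∃ L : List (List ℕ), ∃ t, i < Nat.clog 2 I.X.n →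
      (∃ l : List (I.X.SplitPath I.x i),
        IsKLightest id (fun p : I.X.SplitPath I.x i => (I.X.split I.x i).weight p.1) I.k l ∧
        L = l.map WGraph.SplitPath.words) ∧ A (kSiSP.enc (I.sampled i)) (encodeSeqs L) t ∧ t ≤ T := by
    intro i
    by_cases hi : i < Nat.clog 2 I.X.n
    · obtain ⟨out, t, ha, ⟨l, hl, rfl⟩, ht⟩ := h i hi
      exact ⟨_, t, fun _ => ⟨⟨l, hl, rfl⟩, ha, ht⟩⟩
    -- Dummy values beyond the last round, so that outputs and times can be chosen as functions on
    -- all of `ℕ`.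
    · exact ⟨[], 0, fun h => absurd h hi⟩
  choose Ls ts hLs using h'
  have hin : ∀ j < I.X.m, (kSiSC.enc I).1.getD (4 + (j + j)) 0 = I.X.fstWord j ∧
      (kSiSC.enc I).1.getD (5 + (j + j)) 0 = I.X.sndWord j := by
    intro j hj
    have := WGraph.getD_flatMap_pair I.X.fstWord I.X.sndWord hj
    rw [← WGraph.edgeWords_eq] at this
    refine ⟨?_, ?_⟩
    · rw [show 4 + (j + j) = j + j + 4 by omega]
      exact this.1
    · rw [show 5 + (j + j) = j + j + 1 + 4 by omega]
      exact this.2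
  have hwt : ∀ j < I.X.m, (kSiSC.enc I).2.getD j 0 =
      I.X.wordWeight (I.X.fstWord j) (I.X.sndWord j) := by
    intro j hj
    change I.X.edgeWeights.getD j 0 = _
    rw [WGraph.edgeWeights_eq]
    simp [hj]
  obtain ⟨W, hW, t, hH, ht⟩ := program_halts (O := A) (n := I.X.n) (m := I.X.m) (k := I.k)
    (x := I.x) (N := Nat.clog 2 I.X.n) (T := T) (Ls := Ls) (ts := ts) (d := kSiSC.enc I) rfl rfl rfl
    rfl (fun j hj => (hin j hj).1) (fun j hj => (hin j hj).2) hwt WGraph.wordWeight_comm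
    (fun j hj => WGraph.fstWord_lt hj) (fun j hj => WGraph.sndWord_lt hj) I.x.2
    (fun i => (Nat.lt_clog_iff_pow_lt one_lt_two).symm)
    (fun i hi => WGraph.enc_sampled I i ▸ (hLs i hi).2.1)
    (fun i hi ws hws => by
      obtain ⟨l, -, hl⟩ := (hLs i hi).1
      rw [hl] at hws
      obtain ⟨p, -, rfl⟩ := List.mem_map.1 hws
      exact p.valid_words)
    (fun i hi => hA.length_le (hLs i hi).2.1) (fun i hi => (hLs i hi).2.2)
  obtain ⟨l, hl, hout⟩ := WGraph.correct_of_lightest (Nat.le_pow_clog one_lt_two I.X.n) hW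
    fun i hi => (hLs i hi).1
  refine ⟨_, t, ?_, ⟨l, hl, rfl⟩, ht⟩
  rw [← hout]
  simpa only [WGraph.enc_sampled] using hH

theorem KSiSCInst.one_le_n (I : KSiSCInst) : 1 ≤ I.X.n := by
  have := I.x.2
  omega

/-- Only the bound `N * T` on the number of listed paths is used, so the estimate is uniform in `k`.
-/
theorem quadratic_bound {N k T S : ℕ} :
    64 * (N * (min k (N * T) + T) + (N + 1) * S) ≤ 64 * (N + 1) ^ 2 * (T + S) := by
  have h1 : min k (N * T) ≤ N * T := min_le_right _ _
  generalize min k (N * T) = M at *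
  have h2 : N * M ≤ N * (N * T) := Nat.mul_le_mul_left _ h1
  nlinarith [Nat.zero_le (N * N * S), Nat.zero_le (N * S), Nat.zero_le (N * T)]

theorem mainTheorem8 :
    ∃ R : Prog,
      -- `k`-SiSC tilde-sparse `(m + n)` reduces to `k`-SiSP
      R.IsTildeSparseReduction kSiSC kSiSP (fun m n => m + n) ∧
      -- the reduction calls `k`-SiSP exactly on the `⌈log n⌉` bit-sampled graphs
      (∃ C d : ℕ, ∀ (A : Algo) (T : ℕ → ℕ → ℕ → ℕ), A.IsAlgorithm →
        A.SolvesIn kSiSP (fun J => T J.X.n J.X.m J.k) →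
        ∀ I : KSiSCInst, ∃ out t,
          R.Halts A (kSiSC.enc I) out t
            ((List.range (Nat.clog 2 I.X.n)).map fun i => kSiSP.enc (I.sampled i)) ∧
          kSiSC.Correct I out ∧
          t ≤ C * (Nat.clog 2 I.X.n + 1) ^ d * (T (I.X.n + 1) I.X.m I.k + (I.X.m + I.X.n))) ∧
      -- an `O(k (m + n log n))` program for `k`-SiSP yields an `O(k log n (m + n log n))`
      -- program for `k`-SiSC
      (∀ C : ℕ, ∃ C' : ℕ, ∀ S : Prog,
        S.algo.SolvesIn kSiSP
          (fun J => C * (J.k * (J.X.m + J.X.n * Nat.clog 2 J.X.n))) →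
        ∀ I : KSiSCInst, 2 ≤ I.X.n → ∃ out t,
          R.algoWith S.algo (kSiSC.enc I) out t ∧ kSiSC.Correct I out ∧
          t ≤ C' * (I.k * Nat.clog 2 I.X.n * (I.X.m + I.X.n * Nat.clog 2 I.X.n))) := by
  refine ⟨CycleReduction.program, ⟨⟨2, 1, ?_⟩, fun D => ⟨64 * (D + 1), 2, ?_⟩⟩, ⟨64, 2, ?_⟩,
    fun C => ⟨64 * (4 * C + 3), ?_⟩⟩
  · intro A hA hsol I
    choose out ts hts using fun i => hsol (I.sampled i)
    -- No time bound is given here; the sum of the times of the finitely many calls serves as one.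
    obtain ⟨o, t, hH, hc, -⟩ := CycleReduction.program_spec hA I
      (T := ∑ i ∈ Finset.range (Nat.clog 2 I.X.n), ts i) fun i hi =>
        ⟨out i, ts i, (hts i).1, (hts i).2,
          Finset.single_le_sum (fun _ _ => Nat.zero_le _) (Finset.mem_range.2 hi)⟩
    have hn := I.one_le_n
    refine ⟨o, t, _, hH, hc, ?_, ?_⟩
    · rw [List.length_map, List.length_range, pow_one]
      change Nat.clog 2 I.X.n ≤ 2 * (Nat.clog 2 I.X.n + 1)
      omega
    · intro y hy
      obtain ⟨i, -, rfl⟩ := List.mem_map.1 hy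
      refine ⟨I.sampled i, rfl, rfl, ?_, ?_⟩
      · change I.X.n + 1 ≤ 2 * (Nat.clog 2 I.X.n + 1) ^ 1 * I.X.n
        nlinarith [Nat.zero_le (Nat.clog 2 I.X.n * I.X.n)]
      · change I.X.m ≤ 2 * (Nat.clog 2 I.X.n + 1) ^ 1 * I.X.m
        nlinarith [Nat.zero_le (Nat.clog 2 I.X.n * I.X.m)]
  · intro A T hA hT hsol I
    obtain ⟨out, t, hH, hc, ht⟩ := CycleReduction.program_spec hA I
      (T := T (I.X.n + 1) I.X.m I.k) fun i _ => hsol (I.sampled i)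
    refine ⟨out, t, ⟨_, hH⟩, hc, ht.trans ?_⟩
    change _ ≤ 64 * (D + 1) * (Nat.clog 2 I.X.n + 1) ^ 2 *
      (T I.X.n I.X.m I.k + (I.X.m + I.X.n))
    rcases Nat.lt_or_ge I.X.n 2 with h1 | h2
    -- With a single vertex there is no round at all. The case is separate because the doubling
    -- condition is only available for `n ≥ 2`.
    · rw [Nat.clog_of_right_le_one (by omega)]
      simp only [zero_mul, zero_add, one_mul, one_pow, mul_one]
      nlinarith [Nat.zero_le (D * (T I.X.n I.X.m I.k + (I.X.m + I.X.n)))]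
    · refine quadratic_bound.trans ?_
      have h3 : T (I.X.n + 1) I.X.m I.k ≤ D * T I.X.n I.X.m I.k :=
        (hT.1 _ _ _ _ _ (by omega) (by omega)).trans (hT.2 _ _ _ h2)
      calc _ ≤ 64 * (Nat.clog 2 I.X.n + 1) ^ 2 *
            ((D + 1) * (T I.X.n I.X.m I.k + (I.X.m + I.X.n))) := by
            refine Nat.mul_le_mul_left _ ?_
            nlinarith [Nat.zero_le (D * (I.X.m + I.X.n))]
        _ = _ := by ring
  · intro A T hA hsol I
    obtain ⟨out, t, hH, hc, ht⟩ := CycleReduction.program_spec hA I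
      (T := T (I.X.n + 1) I.X.m I.k) fun i _ => hsol (I.sampled i)
    exact ⟨out, t, hH, hc, ht.trans quadratic_bound⟩
  · intro S hsol I hn
    obtain ⟨out, t, hH, hc, ht⟩ := CycleReduction.program_spec S.algo_isAlgorithm I
      (T := C * (I.k * (I.X.m + (I.X.n + 1) * Nat.clog 2 (I.X.n + 1)))) fun i _ =>
        hsol (I.sampled i)
    refine ⟨out, t, ⟨_, hH⟩, hc, ht.trans ?_⟩
    have hk := I.k_pos
    have hN : 1 ≤ Nat.clog 2 I.X.n := Nat.clog_pos one_lt_two hn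
    have hN' : Nat.clog 2 (I.X.n + 1) ≤ Nat.clog 2 I.X.n + 1 := by
      rw [Nat.clog_le_iff_le_pow one_lt_two, pow_succ]
      have := Nat.le_pow_clog one_lt_two I.X.n
      omega
    generalize I.k = k at *
    generalize I.X.m = m at *
    generalize I.X.n = n at *
    generalize Nat.clog 2 (n + 1) = N' at *
    generalize Nat.clog 2 n = N at *
    -- The extra vertex costs a factor `4`: for `n ≥ 2`, both `n + 1 ≤ 2n` and `⌈log (n + 1)⌉ ≤ ⌈log
    -- n⌉ + 1 ≤ 2⌈log n⌉`.
    have h1 : (n + 1) * N' ≤ (2 * n) * (2 * N) := Nat.mul_le_mul (by omega) (by omega)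
    have h2 : C * (k * (m + (n + 1) * N')) ≤ 4 * C * (k * (m + n * N)) := by
      rw [mul_comm 4 C, mul_assoc]
      refine Nat.mul_le_mul_left _ ?_
      rw [mul_left_comm]
      refine Nat.mul_le_mul_left _ ?_
      nlinarith
    generalize C * (k * (m + (n + 1) * N')) = T at *
    -- This time the bound `k` is used, since `N * T` would bring in a second logarithmic factor.
    have h3 : min k (N * T) ≤ k * (m + n * N) := by
      refine (min_le_left _ _).trans (Nat.le_mul_of_pos_right _ ?_)
      have := Nat.mul_pos (by omega : 0 < n) hN
      omega
    have h4 : m + n ≤ k * (m + n * N) := by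
      have := Nat.le_mul_of_pos_right n hN
      exact (by omega : m + n ≤ m + n * N).trans (Nat.le_mul_of_pos_left _ hk)
    -- In `4 * C + 3`, the subroutine contributes `4 * C`, the listed paths `1`, and the linear work
    -- `2` because `N + 1 ≤ 2 * N`.
    calc 64 * (N * (min k (N * T) + T) + (N + 1) * (m + n))
        ≤ 64 * (N * (k * (m + n * N) + 4 * C * (k * (m + n * N))) +
            (2 * N) * (k * (m + n * N))) := by
          gcongr
          omega
      _ = 64 * (4 * C + 3) * (k * N * (m + n * N)) := by ring
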